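/- **Setting.** Let $m,n\ge 1$, $E\in M(m,\mathbb R)$, $H\in M(n,\mathbb R)$, and $c^{A}:=\exp((\log c)A)$ for $c>0$ and a square matrix $A$. An *operator fractional Brownian field* (OFBF) with exponents $(E,H)$ is a field $B_{E,H}=\{B_{E,H}(t)\}_{t\in\mathbb R^m}$ with values in $\mathbb R^n$ that is Gaussian with mean zero, has stationary increments, satisfies $\{B_{E,H}(c^{E}t)\}_t\overset{\mathcal L}{=}\{c^{H}B_{E,H}(t)\}_t$ for all $c>0$, and is proper (for $t\neq0$ the law of $B_{E,H}(t)$ is not carried by a proper linear subspace of $\mathbb R^n$). Here $\overset{\mathcal L}{=}$ is equality of finite-dimensional distributions. A matrix function $f$ on $\mathbb R^m$ is $(E,H)$-*left-homogeneous* if $f(c^{E}x)=c^{H}f(x)$ for all $c>0$, $x\ne0$. A *Gaussian random measure on $\mathbb R^m$ with Lebesgue control* with values in $\mathbb R^n$ or $\mathbb C^n$ is a centred jointly Gaussian family $W(A)$, indexed by the Borel sets $A$ of finite measure, with $\mathbb E[W(A)W(A')^*]=|A\cap A'|\,I$; in the complex case it is *Hermitian* if $W(-A)=\overline{W(A)}$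 a.s. Integrals of matrix-valued $L^2$ kernels against $W$ are $L^2$-limits of integrals of simple functions. **Theorem.** Let $B_{E,H}$ be an OFBF with exponents $(E,H)$, where $E$ and $H$ are diagonalizable with real eigenvalues and real eigenvectors, $$0<\min\operatorname{eig}(H)\le\max\operatorname{eig}(H)<\min\operatorname{eig}(E),\qquad \max\operatorname{eig}(H)+\tfrac12\operatorname{tr}(E)<m\,\min\operatorname{eig}(E).$$ Let $g:\mathbb R^m\to M(n,\mathbb C)$ be a spectral filter of $B_{E,H}$: $g$ is $(E^*,-H-\tfrac12\operatorname{tr}(E^*)I)$-left-homogeneous and $$\{B_{E,H}(t)\}_{t}\overset{\mathcal L}{=}\Big\{\int_{\mathbb R^m}(e^{i\langle x,t\rangle}-1)\,g(x)\,\widetilde B(dx)\Big\}_{t},$$ where the kernels $(e^{i\langle x,t\rangle}-1)g(x)$ are in $L^2(\mathbb R^m)$ and $\widetilde B$ is a $\mathbb C^n$-valued Hermitian Gaussian random measure with Lebesgue control. Assume that the entrywise mixed partial derivative $\dfrac{\partial^m g}{\partial x_1\cdots\partial x_m}$ exists at almost every point of $\mathbb R^m$, and that it is bounded on $S_0$ (by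 one constant at all points of $S_0$ at which it exists). Here $S_0=\{\|x\|_0=1\}$ for a norm $\|\cdot\|_0$ on $\mathbb R^m$ such that $(r,\theta)\mapsto r^{E^*}\theta$ is a homeomorphism from $(0,\infty)\times S_0$ onto $\mathbb R^m\setminus\{0\}$. Then there is a function $\varphi:\mathbb R^m\to M(n,\mathbb R)$ such that 1. $\varphi(t-\cdot)-\varphi(-\cdot)\in L^2(\mathbb R^m)$ for every $t\in\mathbb R^m$; 2. $\varphi$ is $(E,H-\tfrac12\operatorname{tr}(E)I)$-left-homogeneous; 3. for every $\mathbb R^n$-valued Gaussian random measure $B(du)$ on $\mathbb R^m$ with Lebesgue control (and such random measures exist), $$\{B_{E,H}(t)\}_{t\in\mathbb R^m}\overset{\mathcal L}{=}\Big\{\int_{\mathbb R^m}\big(\varphi(t-u)-\varphi(-u)\big)\,B(du)\Big\}_{t\in\mathbb R^m}.$$ -/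

import Mathlib

open MeasureTheory ProbabilityTheory Filter Topology
open scoped Matrix

noncomputable section

namespace OFBF

/-- `ℝ^m` (or `ℂ^m`) with its Euclidean structure. -/
abbrev Vec (𝕜 : Type*) (m : ℕ) : Type _ := EuclideanSpace 𝕜 (Fin m)

/-- Real or complex `n × n` matrices. -/
abbrev Mat (𝕜 : Type*) (n : ℕ) : Type _ := Matrix (Fin n) (Fin n) 𝕜

/-- `c ^ A = exp ((log c) A)` for a real square matrix `A` (used for `c > 0`). -/
def cpow {k : ℕ} (c : ℝ) (A : Mat ℝ k) : Mat ℝ k :=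
  NormedSpace.exp (Real.log c • A)

/-- The action of a square matrix on a Euclidean vector. -/
def act {𝕜 : Type*} [RCLike 𝕜] {k : ℕ} (A : Mat 𝕜 k) (x : Vec 𝕜 k) : Vec 𝕜 k :=
  WithLp.toLp 2 (A *ᵥ x.ofLp)

/-- Diagonalizable with real eigenvalues and real eigenvectors: `A = W diag(d) W⁻¹` over `ℝ`. -/
def RealDiagonalizable {k : ℕ} (A : Mat ℝ k) : Prop :=
  ∃ (W : Mat ℝ k) (d : Fin k → ℝ), IsUnit W.det ∧ A = W * Matrix.diagonal d * W⁻¹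

/-- Equality of all finite-dimensional distributions of two fields (with the same index set and
the same state space, possibly on different probability spaces). -/
def SameFDD {T S Ω Ω' : Type*} [MeasurableSpace S] [MeasurableSpace Ω] [MeasurableSpace Ω']
    (X : T → Ω → S) (P : Measure Ω) (Y : T → Ω' → S) (P' : Measure Ω') : Prop :=
  ∀ I : Finset T, IdentDistrib (fun ω (t : I) => X t ω) (fun ω (t : I) => Y t ω) P P'

/-- `X` is a (proper) operator fractional Brownian field with domain exponent `E` and range
exponent `H`. -/
structure IsOFBF {m n : ℕ} {Ω : Type*} [MeasurableSpace Ω] (E : Mat ℝ m) (H : Mat ℝ n)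
    (X : Vec ℝ m → Ω → Vec ℝ n) (P : Measure Ω) : Prop where
  gaussian : IsGaussianProcess X P
  mean_zero : ∀ t, ∫ ω, X t ω ∂P = 0
  stationary_increments : ∀ h : Vec ℝ m,
    SameFDD (fun t ω => X (t + h) ω - X h ω) P (fun t ω => X t ω - X 0 ω) P
  self_similar : ∀ c : ℝ, 0 < c →
    SameFDD (fun t ω => X (act (cpow c E) t) ω) P (fun t ω => act (cpow c H) (X t ω)) P
  proper : ∀ t : Vec ℝ m, t ≠ 0 → ∀ S : Submodule ℝ (Vec ℝ n), S ≠ ⊤ → ¬ ∀ᵐ ω ∂P, X t ω ∈ S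

/-- `(E, H)`-left-homogeneity: `f (c ^ E x) = c ^ H f(x)` for all `c > 0` and `x ≠ 0`. -/
def LeftHomogeneous {𝕜 : Type*} [RCLike 𝕜] {m n : ℕ} (E : Mat ℝ m) (H : Mat ℝ n)
    (f : Vec ℝ m → Mat 𝕜 n) : Prop :=
  ∀ c : ℝ, 0 < c → ∀ x : Vec ℝ m, x ≠ 0 →
    f (act (cpow c E) x) = (cpow c H).map (algebraMap ℝ 𝕜) * f x

/-- `N` is a norm on `ℝ^m` for which `(r, θ) ↦ r ^ E θ` is a homeomorphism from
`(0, ∞) × {N = 1}` onto `ℝ^m \ {0}`. -/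
def IsPolarNorm {m : ℕ} (E : Mat ℝ m) (N : Seminorm ℝ (Vec ℝ m)) : Prop :=
  (∀ x, N x = 0 → x = 0) ∧
  ∃ Ψ : (Set.Ioi (0 : ℝ) × {x : Vec ℝ m // N x = 1}) ≃ₜ {x : Vec ℝ m // x ≠ 0},
    ∀ p, (Ψ p : Vec ℝ m) = act (cpow (p.1 : ℝ) E) (p.2 : Vec ℝ m)

/-- `HasIterPartialAt [i₁, …, iₖ] F d x`: the iterated partial derivative
`∂/∂x_{i₁} (∂/∂x_{i₂} (⋯ ∂F/∂x_{iₖ}))` exists at `x` and equals `d`. At each stage the inner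
derivative has to exist near `x` on the line in the direction of the next differentiation. -/
def HasIterPartialAt {m : ℕ} : List (Fin m) → (Vec ℝ m → ℂ) → ℂ → Vec ℝ m → Prop
  | [], F, d, x => F x = d
  | i :: l, F, d, x => ∃ G : ℝ → ℂ,
      (∀ᶠ s in 𝓝 (0 : ℝ), HasIterPartialAt l F (G s) (x + s • EuclideanSpace.single i (1 : ℝ))) ∧
      HasDerivAt G d 0

/-- The matrix-valued `g` has, entrywise, the mixed partial derivative
`∂^m g / ∂x_1 ⋯ ∂x_m` at `x`, with value `D`. -/
def HasMixedPartialAt {m n : ℕ} (g : Vec ℝ m → Mat ℂ n) (D : Mat ℂ n) (x : Vec ℝ m) : Prop :=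
  ∀ i j, HasIterPartialAt (List.finRange m) (fun y => g y i j) (D i j) x

/-- `W` is a (real or complex) Gaussian random measure on `ℝ^m` with Lebesgue control measure:
a centred, jointly Gaussian family `W(A)`, indexed by the Borel sets `A` of finite measure, with
`E[W(A) W(A')^*] = |A ∩ A'| I`. (The values of `W` at other sets are irrelevant.) -/
structure IsGaussianRandomMeasure {𝕜 : Type*} [RCLike 𝕜] {m n : ℕ} {Ω : Type*}
    [MeasurableSpace Ω] (W : Set (Vec ℝ m) → Ω → Vec 𝕜 n) (P : Measure Ω) : Prop where
  gaussian : IsGaussianProcess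
    (fun A : {A : Set (Vec ℝ m) // MeasurableSet A ∧ volume A < ⊤} => W A) P
  mean_zero : ∀ A, MeasurableSet A → volume A < ⊤ → ∫ ω, W A ω ∂P = 0
  covariance : ∀ A A', MeasurableSet A → volume A < ⊤ → MeasurableSet A' → volume A' < ⊤ →
    ∀ i j, ∫ ω, W A ω i * starRingEnd 𝕜 (W A' ω j) ∂P =
      if i = j then (((volume (A ∩ A')).toReal : ℝ) : 𝕜) else 0

/-- A complex Gaussian random measure is Hermitian if `W(-A)` is the complex conjugate of
`W(A)` almost surely. -/
def IsHermitianMeasure {m n : ℕ} {Ω : Type*} [MeasurableSpace Ω]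
    (W : Set (Vec ℝ m) → Ω → Vec ℂ n) (P : Measure Ω) : Prop :=
  ∀ A, MeasurableSet A → volume A < ⊤ →
    ∀ᵐ ω ∂P, ∀ i, W (Neg.neg ⁻¹' A) ω i = starRingEnd ℂ (W A ω i)

/-- The stochastic integral `∑_M M W(s⁻¹{M})` of a matrix-valued simple function. -/
def simpleIntegral {𝕜 : Type*} [RCLike 𝕜] {m n : ℕ} {Ω : Type*}
    (W : Set (Vec ℝ m) → Ω → Vec 𝕜 n) (s : SimpleFunc (Vec ℝ m) (Mat 𝕜 n)) (ω : Ω) : Vec 𝕜 n :=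
  ∑ M ∈ s.range, act M (W (s ⁻¹' {M}) ω)

/-- `Y` is (a version of) the stochastic integral `∫ K(x) W(dx)` of the square integrable
matrix-valued kernel `K`: it is the `L²(P)`-limit of the integrals of simple functions that
converge to `K` in `L²(ℝ^m)`. It is determined almost surely by `W` and `K`. -/
def IsStochasticIntegral {𝕜 : Type*} [RCLike 𝕜] {m n : ℕ} {Ω : Type*} [MeasurableSpace Ω]
    (W : Set (Vec ℝ m) → Ω → Vec 𝕜 n) (P : Measure Ω) (K : Vec ℝ m → Mat 𝕜 n)
    (Y : Ω → Vec 𝕜 n) : Prop :=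
  (∀ i j, MemLp (fun x => K x i j) 2 volume) ∧ MemLp Y 2 P ∧
  ∃ s : ℕ → SimpleFunc (Vec ℝ m) (Mat 𝕜 n),
    (∀ k, ∀ M, M ≠ 0 → volume (s k ⁻¹' {M}) < ⊤) ∧
    (∀ i j, Tendsto (fun k => eLpNorm (fun x => s k x i j - K x i j) 2 volume) atTop (𝓝 0)) ∧
    Tendsto (fun k => eLpNorm (fun ω => simpleIntegral W (s k) ω - Y ω) 2 P) atTop (𝓝 0)

/-- The harmonizable representation
`{X(t)}_t = {∫ (e^{i⟨x,t⟩} - 1) g(x) W(dx)}_t` in law, the real field `X` being regarded as a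
`ℂ^n`-valued field. -/
def HasHarmonizableRepr {m n : ℕ} {Ω Ω' : Type*} [MeasurableSpace Ω] [MeasurableSpace Ω']
    (X : Vec ℝ m → Ω → Vec ℝ n) (P : Measure Ω) (g : Vec ℝ m → Mat ℂ n)
    (W : Set (Vec ℝ m) → Ω' → Vec ℂ n) (P' : Measure Ω') : Prop :=
  ∃ Y : Vec ℝ m → Ω' → Vec ℂ n,
    (∀ t, IsStochasticIntegral W P'
      (fun x => (Complex.exp (Complex.I * (inner ℝ x t : ℝ)) - 1) • g x) (Y t)) ∧
    SameFDD (fun t ω => (WithLp.toLp 2 (fun i => (X t ω i : ℂ)) : Vec ℂ n)) P Y P'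

/-- The moving average representation `{X(t)}_t = {∫ (φ(t-u) - φ(-u)) W(du)}_t` in law. -/
def HasMovingAverageRepr {m n : ℕ} {Ω Ω' : Type*} [MeasurableSpace Ω] [MeasurableSpace Ω']
    (X : Vec ℝ m → Ω → Vec ℝ n) (P : Measure Ω) (φ : Vec ℝ m → Mat ℝ n)
    (W : Set (Vec ℝ m) → Ω' → Vec ℝ n) (P' : Measure Ω') : Prop :=
  ∃ Y : Vec ℝ m → Ω' → Vec ℝ n,
    (∀ t, IsStochasticIntegral W P' (fun u => φ (t - u) - φ (-u)) (Y t)) ∧ SameFDD X P Y P'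

end OFBF

end

open OFBF

noncomputable section

namespace OFBF

/-! ### Inner products of square integrable functions. -/

section SquareIntegrable

variable {α 𝕜 : Type*} [RCLike 𝕜] [MeasurableSpace α] {μ : Measure α}

/-! The moving average kernel is the Fourier transform of the spectral filter. Write a = tr(E)/2.
Averaging the eigenvalue condition over the m eigenvalues of E gives h < a for each eigenvalue h of
H (`eigenvalue_lt_half_trace`). On a shell of size c for the action of c^{E*}, the volume is of
order c^{2a} and homogeneity bounds g by terms c^{-a-h}. So the integral of |g| over the shell is
controlled by terms c^{a-h}, summable as c → 0, and that of |g|² by terms c^{-h-h'}, summable as c →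
∞. Hence g is integrable near 0 and square integrable away from 0
(`exists_integrable_memLp_decomposition`), and its Fourier transform as a tempered distribution is a
function F.

Uniqueness of the transform turns the scaling of g into the scaling of F with exponent H - aI,
outside null sets. Modulation of g becomes translation of F, so the increments of F are the
transforms of the harmonizable kernels: by Plancherel they are square integrable, with the same
inner products. Since the field is real, these kernels are Hermitian
(`IsStochasticIntegral.kernel_hermitian`), and so the increments of F are real. The kernel φ is the
real part of F, rescaled and reflected, and modified on a null set to be homogeneous everywhere
(`exists_leftHomogeneous_ae_eq`).

It remains to compare laws. Both fields are centred Gaussian, so covariances suffice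
(`sameFDD_of_covariance_eq`). The isometry of the stochastic integral writes each covariance as an
inner product of kernels, and Plancherel identifies the two (`exists_movingAverage_kernel`). A
Gaussian random measure is obtained from the isonormal process over L²(ℝ^m; ℝ^n). -/

theorem integrable_mul_conj {a b : α → 𝕜} (ha : MemLp a 2 μ) (hb : MemLp b 2 μ) :
    Integrable (fun x => a x * starRingEnd 𝕜 (b x)) μ :=
  ha.integrable_mul hb.star

theorem inner_toLp_eq_integral {a b : α → 𝕜} (ha : MemLp a 2 μ) (hb : MemLp b 2 μ) :
    inner 𝕜 (hb.toLp b) (ha.toLp a) = ∫ x, a x * starRingEnd 𝕜 (b x) ∂μ := by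
  rw [L2.inner_def]
  refine integral_congr_ae ?_
  filter_upwards [ha.coeFn_toLp, hb.coeFn_toLp] with x h1 h2
  rw [h1, h2, RCLike.inner_apply]

theorem tendsto_integral_mul_conj {a b : ℕ → α → 𝕜} {a' b' : α → 𝕜}
    (ha : ∀ k, MemLp (a k) 2 μ) (ha' : MemLp a' 2 μ)
    (hb : ∀ k, MemLp (b k) 2 μ) (hb' : MemLp b' 2 μ)
    (hta : Tendsto (fun k => eLpNorm (fun x => a k x - a' x) 2 μ) atTop (𝓝 0))
    (htb : Tendsto (fun k => eLpNorm (fun x => b k x - b' x) 2 μ) atTop (𝓝 0)) :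
    Tendsto (fun k => ∫ x, a k x * starRingEnd 𝕜 (b k x) ∂μ) atTop
      (𝓝 (∫ x, a' x * starRingEnd 𝕜 (b' x) ∂μ)) := by
  have h1 := (Lp.tendsto_Lp_iff_tendsto_eLpNorm'' a ha a' ha').2 hta
  have h2 := (Lp.tendsto_Lp_iff_tendsto_eLpNorm'' b hb b' hb').2 htb
  simp_rw [← inner_toLp_eq_integral ha' hb', fun k => (inner_toLp_eq_integral (ha k) (hb k)).symm]
  exact h2.inner h1

theorem ae_eq_of_integral_sub_mul_conj {a b : α → 𝕜} (ha : MemLp a 2 μ) (hb : MemLp b 2 μ)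
    (h : ∫ x, (a x - b x) * starRingEnd 𝕜 (a x - b x) ∂μ = 0) : a =ᵐ[μ] b := by
  have hab : MemLp (fun x => a x - b x) 2 μ := ha.sub hb
  rw [← inner_toLp_eq_integral hab hab, inner_self_eq_zero] at h
  have := hab.coeFn_toLp
  rw [h] at this
  filter_upwards [this, Lp.coeFn_zero 𝕜 2 μ] with x h1 h2
  rw [h2] at h1
  exact sub_eq_zero.1 h1.symm

theorem integral_sub_mul_conj {a b : α → 𝕜} (ha : MemLp a 2 μ) (hb : MemLp b 2 μ) :
    ∫ x, (a x - b x) * starRingEnd 𝕜 (a x - b x) ∂μ =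
      ∫ x, a x * starRingEnd 𝕜 (a x) ∂μ - ∫ x, a x * starRingEnd 𝕜 (b x) ∂μ
        - ∫ x, b x * starRingEnd 𝕜 (a x) ∂μ + ∫ x, b x * starRingEnd 𝕜 (b x) ∂μ := by
  have haa := integrable_mul_conj ha ha
  have hab := integrable_mul_conj ha hb
  have hba := integrable_mul_conj hb ha
  have hbb := integrable_mul_conj hb hb
  have h1 := integral_sub haa hab
  have h2 := integral_sub (haa.sub hab) hba
  have h3 := integral_add ((haa.sub hab).sub hba) hbb
  simp only [Pi.sub_apply] at h1 h2 h3
  rw [← h1, ← h2, ← h3]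
  congr 1 with x
  simp only [map_sub]
  ring

end SquareIntegrable

/-! ### Gaussian spaces, their L²-closures, and laws determined by covariances. -/

section GaussianSpace

variable {Ω : Type*} [MeasurableSpace Ω] {P : Measure Ω}

theorem hasGaussianLaw_iff_charFun_of_integral_eq_zero [IsProbabilityMeasure P] {X : Ω → ℝ}
    (hX : MemLp X 2 P) (h0 : ∫ ω, X ω ∂P = 0) :
    HasGaussianLaw X P ↔ ∀ t : ℝ, charFun (P.map X) t =
      Complex.exp (-((t ^ 2 * ∫ ω, X ω * X ω ∂P : ℝ) : ℂ) / 2) := by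
  rw [hasGaussianLaw_iff_charFun_map_eq hX.aestronglyMeasurable.aemeasurable]
  refine forall_congr' fun t => ?_
  have h1 : ∫ ω, inner ℝ t (X ω) ∂P = 0 := by
    simp [integral_mul_const, h0]
  have h2 : Var[fun ω => inner ℝ t (X ω); P] = t ^ 2 * ∫ ω, X ω * X ω ∂P := by
    rw [variance_of_integral_eq_zero _ h1, ← integral_const_mul]
    · congr 1 with ω
      simp only [RCLike.inner_apply, conj_trivial]
      ring
    · exact (hX.aestronglyMeasurable.aemeasurable.const_inner)
  rw [h1, h2]
  simp [neg_div]

/-- L² convergence implies convergence in distribution, so the characteristic functions converge;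
the second moments converge as well, and the limit is again the characteristic function of a centred
Gaussian. -/
theorem hasGaussianLaw_of_tendsto_eLpNorm [IsProbabilityMeasure P] {X : ℕ → Ω → ℝ} {Y : Ω → ℝ}
    (hX : ∀ k, HasGaussianLaw (X k) P) (h0 : ∀ k, ∫ ω, X k ω ∂P = 0) (hY : MemLp Y 2 P)
    (h : Tendsto (fun k => eLpNorm (fun ω => X k ω - Y ω) 2 P) atTop (𝓝 0)) :
    HasGaussianLaw Y P ∧ ∫ ω, Y ω ∂P = 0 := by
  have hXm : ∀ k, MemLp (X k) 2 P := fun k => (hX k).memLp_two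
  have hmean : ∫ ω, Y ω ∂P = 0 := by
    -- The mean is the inner product with the constant 1, hence continuous in L².
    have h1 := tendsto_integral_mul_conj (𝕜 := ℝ) hXm hY (fun _ => memLp_const (1 : ℝ))
      (memLp_const 1) h (by simp)
    simp only [map_one, mul_one, h0] at h1
    exact tendsto_nhds_unique h1 tendsto_const_nhds |>.symm ▸ rfl
  refine ⟨(hasGaussianLaw_iff_charFun_of_integral_eq_zero hY hmean).2 fun t => ?_, hmean⟩
  have hdist : TendstoInDistribution X atTop Y (fun _ => P) P :=
    (tendstoInMeasure_of_tendsto_eLpNorm two_ne_zero (fun k => (hXm k).1) hY.1 h).tendstoInDistribution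
      fun k => (hX k).aemeasurable
  have h1 := ProbabilityMeasure.tendsto_iff_tendsto_charFun.1 hdist.tendsto t
  have h2 := tendsto_integral_mul_conj (𝕜 := ℝ) hXm hY hXm hY h h
  simp only [conj_trivial] at h2
  have h3 : Tendsto (fun k => Complex.exp (-((t ^ 2 * ∫ ω, X k ω * X k ω ∂P : ℝ) : ℂ) / 2)) atTop
      (𝓝 (Complex.exp (-((t ^ 2 * ∫ ω, Y ω * Y ω ∂P : ℝ) : ℂ) / 2))) := by
    have hc : Continuous fun r : ℝ => Complex.exp (-((t ^ 2 * r : ℝ) : ℂ) / 2) := by fun_prop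
    exact (hc.tendsto _).comp h2
  refine tendsto_nhds_unique h1 (h3.congr fun k => ?_)
  exact ((hasGaussianLaw_iff_charFun_of_integral_eq_zero (hXm k) (h0 k)).1 (hX k) t).symm

/-- A linear space of centred Gaussian random variables. -/
def IsGaussianSpace (S : Submodule ℝ (Ω → ℝ)) (P : Measure Ω) : Prop :=
  ∀ X ∈ S, HasGaussianLaw X P ∧ ∫ ω, X ω ∂P = 0

/-- The square integrable random variables that are `L²`-limits of sequences in `S`, where the
elements of `S` are square integrable. -/
def limitSpace (S : Submodule ℝ (Ω → ℝ)) (P : Measure Ω) (hS : ∀ X ∈ S, MemLp X 2 P) :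
    Submodule ℝ (Ω → ℝ) where
  carrier := {Y | MemLp Y 2 P ∧ ∃ X : ℕ → Ω → ℝ, (∀ k, X k ∈ S) ∧
    Tendsto (fun k => eLpNorm (fun ω => X k ω - Y ω) 2 P) atTop (𝓝 0)}
  add_mem' := by
    rintro Y Y' ⟨hY, X, hX, h⟩ ⟨hY', X', hX', h'⟩
    refine ⟨hY.add hY', fun k => X k + X' k, fun k => S.add_mem (hX k) (hX' k), ?_⟩
    refine tendsto_of_tendsto_of_tendsto_of_le_of_le tendsto_const_nhds
      (by simpa using h.add h') (fun _ => zero_le) fun k => ?_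
    refine le_of_eq_of_le ?_ (eLpNorm_add_le (((hS _ (hX k)).sub hY).1)
      (((hS _ (hX' k)).sub hY').1) one_le_two)
    congr 1 with ω
    simp only [Pi.add_apply]
    ring
  zero_mem' := ⟨MemLp.zero, fun _ => 0, fun _ => S.zero_mem, by simp⟩
  smul_mem' := by
    rintro c Y ⟨hY, X, hX, h⟩
    refine ⟨hY.const_smul c, fun k => c • X k, fun k => S.smul_mem c (hX k), ?_⟩
    have : ∀ k, eLpNorm (fun ω => (c • X k) ω - (c • Y) ω) 2 P
        = ‖c‖ₑ * eLpNorm (fun ω => X k ω - Y ω) 2 P := fun k => by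
      rw [← eLpNorm_const_smul]
      congr 1 with ω
      simp [mul_sub]
    simp_rw [this]
    simpa using ENNReal.Tendsto.const_mul h (Or.inr (by simp))

theorem IsGaussianSpace.memLp {S : Submodule ℝ (Ω → ℝ)} (h : IsGaussianSpace S P) :
    ∀ X ∈ S, MemLp X 2 P := fun X hX => (h X hX).1.memLp_two

theorem IsGaussianSpace.limitSpace [IsProbabilityMeasure P] {S : Submodule ℝ (Ω → ℝ)}
    (h : IsGaussianSpace S P) : IsGaussianSpace (limitSpace S P h.memLp) P := by
  rintro Y ⟨hY, X, hX, hlim⟩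
  exact hasGaussianLaw_of_tendsto_eLpNorm (fun k => (h _ (hX k)).1) (fun k => (h _ (hX k)).2) hY hlim

theorem _root_.ProbabilityTheory.IsGaussianProcess.isGaussianSpace_span {T : Type*} {Z : T → Ω → ℝ}
    (hZ : IsGaussianProcess Z P) (h0 : ∀ t, ∫ ω, Z t ω ∂P = 0) :
    IsGaussianSpace (Submodule.span ℝ (Set.range Z)) P := by
  intro X hX
  obtain ⟨c, rfl⟩ := Finsupp.mem_span_range_iff_exists_finsupp.1 hX
  have h1 := (hZ.smul c).hasGaussianLaw_fun_sum (I := c.support)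
  have h2 : (c.sum fun i a => a • Z i) = fun ω => ∑ i ∈ c.support, c i • Z i ω := by
    ext ω; simp [Finsupp.sum]
  rw [h2]
  refine ⟨h1, ?_⟩
  rw [integral_finsetSum]
  · simp [integral_const_mul, h0]
  · intro t _
    exact ((hZ.hasGaussianLaw_eval t).integrable).const_mul _

theorem continuousLinearMap_pi_euclideanSpace_apply {ι : Type*} [Fintype ι] [DecidableEq ι] {n : ℕ}
    (L : (ι → Vec ℝ n) →L[ℝ] ℝ) (x : ι → Vec ℝ n) :
    L x = ∑ t, ∑ i, L (Pi.single t (EuclideanSpace.single i 1)) * x t i := by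
  have h : x = ∑ t, ∑ i, x t i • (Pi.single t (EuclideanSpace.single i 1) : ι → Vec ℝ n) := by
    ext s j
    simp [Finset.sum_apply, Pi.single_apply, apply_ite]
  conv_lhs => rw [h]
  simp [map_sum, mul_comm]

/-- A linear functional of finitely many values of the field is a linear combination of coordinates,
so it stays in the Gaussian space. -/
theorem IsGaussianSpace.isGaussianProcess {S : Submodule ℝ (Ω → ℝ)} (hS : IsGaussianSpace S P)
    {T : Type*} {n : ℕ} {Z : T → Ω → Vec ℝ n} (hZ : ∀ t i, (fun ω => Z t ω i) ∈ S) :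
    IsGaussianProcess Z P := by
  classical
  refine ⟨fun I => ⟨isGaussian_of_isGaussian_map fun L => ?_⟩⟩
  have hm : AEMeasurable (fun ω => I.restrict fun t => Z t ω) P := by
    refine aemeasurable_pi_lambda _ fun t => ?_
    have : AEMeasurable (fun ω i => Z t ω i) P :=
      aemeasurable_pi_lambda _ fun i => (hS _ (hZ t i)).1.aemeasurable
    exact (PiLp.continuous_toLp 2 _).measurable.comp_aemeasurable this
  rw [AEMeasurable.map_map_of_aemeasurable L.continuous.aemeasurable hm]
  have : L ∘ (fun ω => I.restrict fun t => Z t ω) = ∑ t : I, ∑ i,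
      L (Pi.single t (EuclideanSpace.single i 1)) • fun ω => Z t ω i := by
    ext ω
    rw [Function.comp_apply, continuousLinearMap_pi_euclideanSpace_apply L]
    simp only [Finset.sum_apply, Pi.smul_apply, smul_eq_mul, Finset.restrict]
  rw [this]
  exact (hS _ (S.sum_mem fun (t : I) _ => S.sum_mem fun i _ =>
    S.smul_mem _ (hZ t i))).1.isGaussian_map

/-- The variance of a linear functional is a quadratic form in the covariances. The right-hand side
involves the field only through them, which is why equal covariances force equal laws. -/
theorem _root_.ProbabilityTheory.IsGaussianProcess.charFunDual_map_restrict
    {T : Type*} [DecidableEq T] {n : ℕ}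
    {X : T → Ω → Vec ℝ n} (hX : IsGaussianProcess X P) (hX0 : ∀ t, ∫ ω, X t ω ∂P = 0)
    (I : Finset T) (L : (I → Vec ℝ n) →L[ℝ] ℝ) :
    charFunDual (P.map fun ω => I.restrict fun t => X t ω) L = Complex.exp
      (- ((∑ p : I × Fin n, ∑ q : I × Fin n, L (Pi.single p.1 (EuclideanSpace.single p.2 1)) *
        L (Pi.single q.1 (EuclideanSpace.single q.2 1)) *
          ∫ ω, X p.1 ω p.2 * X q.1 ω q.2 ∂P : ℝ) : ℂ) / 2) := by
  have hXI := hX.hasGaussianLaw I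
  have hco : ∀ (t : T) (i : Fin n), MemLp (fun ω => X t ω i) 2 P := fun t i =>
    ((hX.hasGaussianLaw_eval t).map_fun (EuclideanSpace.proj i)).memLp_two
  have hprob := hXI.isProbabilityMeasure
  have hmean : ∀ (t : T) (i : Fin n), ∫ ω, X t ω i ∂P = 0 := fun t i => by
    have := (EuclideanSpace.proj i : Vec ℝ n →L[ℝ] ℝ).integral_comp_comm
      (hX.hasGaussianLaw_eval t).integrable
    rw [hX0 t, map_zero] at this
    exact this
  have hL : ∀ ω, L (I.restrict fun t => X t ω) = ∑ p : I × Fin n,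
      L (Pi.single p.1 (EuclideanSpace.single p.2 1)) * X p.1 ω p.2 := fun ω => by
    rw [continuousLinearMap_pi_euclideanSpace_apply L, Fintype.sum_prod_type]
    rfl
  have hmL : ∫ ω, L (I.restrict fun t => X t ω) ∂P = 0 := by
    simp_rw [hL]
    rw [integral_finsetSum _ fun p _ => ((hco p.1 p.2).integrable one_le_two).const_mul _]
    simp [integral_const_mul, hmean]
  rw [hXI.charFunDual_map_eq_fun L, hmL, variance_of_integral_eq_zero _ hmL]
  · have : ∫ ω, L (I.restrict fun t => X t ω) ^ 2 ∂P = ∑ p : I × Fin n, ∑ q : I × Fin n,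
        L (Pi.single p.1 (EuclideanSpace.single p.2 1)) *
        L (Pi.single q.1 (EuclideanSpace.single q.2 1)) *
          ∫ ω, X p.1 ω p.2 * X q.1 ω q.2 ∂P := by
      have hint : ∀ p q : I × Fin n, Integrable (fun ω => X p.1 ω p.2 * X q.1 ω q.2) P :=
        fun p q => (hco p.1 p.2).integrable_mul (hco q.1 q.2)
      simp_rw [hL, pow_two, Finset.sum_mul_sum, ← integral_const_mul]
      rw [integral_finsetSum]
      · refine Finset.sum_congr rfl fun p _ => ?_
        rw [integral_finsetSum]
        · refine Finset.sum_congr rfl fun q _ => ?_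
          congr 1 with ω
          ring
        · intro q _
          refine ((hint p q).const_mul (L (Pi.single p.1 (EuclideanSpace.single p.2 1)) *
            L (Pi.single q.1 (EuclideanSpace.single q.2 1)))).congr (ae_of_all _ fun ω => ?_)
          dsimp only
          ring
      · intro p _
        refine integrable_finsetSum _ fun q _ => ?_
        refine ((hint p q).const_mul (L (Pi.single p.1 (EuclideanSpace.single p.2 1)) *
            L (Pi.single q.1 (EuclideanSpace.single q.2 1)))).congr (ae_of_all _ fun ω => ?_)
        dsimp only
        ring
    rw [this]
    simp [neg_div]
  · exact L.continuous.measurable.comp_aemeasurable hXI.aemeasurable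

/-- Two centred Gaussian fields with the same covariances have the same finite-dimensional
distributions. -/
theorem sameFDD_of_covariance_eq {Ω' : Type*} [MeasurableSpace Ω'] {P' : Measure Ω'} {T : Type*}
    {n : ℕ} {X : T → Ω → Vec ℝ n} {Y : T → Ω' → Vec ℝ n}
    (hX : IsGaussianProcess X P) (hY : IsGaussianProcess Y P')
    (hX0 : ∀ t, ∫ ω, X t ω ∂P = 0) (hY0 : ∀ t, ∫ ω, Y t ω ∂P' = 0)
    (hcov : ∀ s t i j, ∫ ω, X s ω i * X t ω j ∂P = ∫ ω, Y s ω i * Y t ω j ∂P') :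
    SameFDD X P Y P' := by
  classical
  intro I
  have hXI := hX.hasGaussianLaw I
  have hYI := hY.hasGaussianLaw I
  refine ⟨hXI.aemeasurable, hYI.aemeasurable, ?_⟩
  have := hXI.isGaussian_map.toIsProbabilityMeasure
  have := hYI.isGaussian_map.toIsProbabilityMeasure
  refine Measure.ext_of_charFunDual (E := I → Vec ℝ n)
    (μ := P.map fun ω => I.restrict fun t => X t ω)
    (ν := P'.map fun ω => I.restrict fun t => Y t ω) ?_
  ext L
  rw [hX.charFunDual_map_restrict hX0, hY.charFunDual_map_restrict hY0]
  simp_rw [hcov]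

end GaussianSpace

/-! ### The stochastic integral: isometry and existence. -/

section StochasticIntegral

variable {𝕜 : Type*} [RCLike 𝕜] {m n : ℕ} {Ω : Type*} [MeasurableSpace Ω] {P : Measure Ω}
  {W : Set (Vec ℝ m) → Ω → Vec 𝕜 n}

theorem IsGaussianRandomMeasure.memLp (hW : IsGaussianRandomMeasure W P) {A : Set (Vec ℝ m)}
    (hA : MeasurableSet A) (hA' : volume A < ⊤) (k : Fin n) : MemLp (fun ω => W A ω k) 2 P := by
  have h : HasGaussianLaw (W A) P := hW.gaussian.hasGaussianLaw_eval ⟨A, hA, hA'⟩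
  exact h.memLp_two.eval_piLp k

/-- A simple kernel all of whose nonzero values are taken on sets of finite measure. -/
def FinMeasSupport (s : SimpleFunc (Vec ℝ m) (Mat 𝕜 n)) : Prop :=
  ∀ M, M ≠ 0 → volume (s ⁻¹' {M}) < ⊤

open Classical in
-- The value 0 is dropped because its level set may have infinite measure, where nothing is known
-- about `W`.
theorem simpleIntegral_apply {Ω : Type*} {W : Set (Vec ℝ m) → Ω → Vec 𝕜 n}
    (s : SimpleFunc (Vec ℝ m) (Mat 𝕜 n)) (ω : Ω) (i : Fin n) :
    simpleIntegral W s ω i =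
      ∑ p ∈ (s.range.filter (· ≠ 0)) ×ˢ (Finset.univ : Finset (Fin n)),
        p.1 i p.2 * W (s ⁻¹' {p.1}) ω p.2 := by
  rw [Finset.sum_product]
  have h : simpleIntegral W s ω i = ∑ M ∈ s.range, ∑ k, M i k * W (s ⁻¹' {M}) ω k := by
    simp only [simpleIntegral, act, WithLp.ofLp_sum, Finset.sum_apply]
    rfl
  rw [h, Finset.sum_filter]
  refine Finset.sum_congr rfl fun M _ => ?_
  split_ifs with hM
  · rfl
  · rw [not_not.1 hM]; simp

open Classical in
theorem simpleFunc_apply (s : SimpleFunc (Vec ℝ m) (Mat 𝕜 n)) (x : Vec ℝ m) (i k : Fin n) :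
    s x i k = ∑ M ∈ s.range.filter (· ≠ 0), (s ⁻¹' {M}).indicator (fun _ => M i k) x := by
  rw [Finset.sum_filter, Finset.sum_eq_single (s x)]
  · split_ifs with h
    · simp
    · rw [not_not.1 h]; rfl
  · intro M _ hM
    split_ifs with h
    · exact Set.indicator_of_notMem (fun hx => hM (by simpa using hx.symm)) _
    · rfl
  · intro h
    exact absurd (s.mem_range_self x) h

theorem simpleFunc_memLp {s : SimpleFunc (Vec ℝ m) (Mat 𝕜 n)} (hs : FinMeasSupport s)
    (i k : Fin n) : MemLp (fun x => s x i k) 2 volume := by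
  classical
  have : (fun x => s x i k) = fun x =>
      ∑ M ∈ s.range.filter (· ≠ 0), (s ⁻¹' {M}).indicator (fun _ => M i k) x := by
    ext x; exact simpleFunc_apply s x i k
  rw [this]
  refine memLp_finsetSum _ fun M hM => ?_
  exact memLp_indicator_const 2 (s.measurableSet_preimage _) _
    (Or.inr (hs M (Finset.mem_filter.1 hM).2).ne)

theorem simpleIntegral_memLp (hW : IsGaussianRandomMeasure W P)
    {s : SimpleFunc (Vec ℝ m) (Mat 𝕜 n)} (hs : FinMeasSupport s)
    (i : Fin n) : MemLp (fun ω => simpleIntegral W s ω i) 2 P := by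
  classical
  simp_rw [simpleIntegral_apply]
  refine memLp_finsetSum _ fun p hp => ?_
  exact (hW.memLp (s.measurableSet_preimage _)
    (hs _ (Finset.mem_filter.1 (Finset.mem_product.1 hp).1).2) p.2).const_mul _

/-- Both sides expand to the same sum over pairs of values M, M', weighted by the volume of the
intersection of their level sets; orthogonality of distinct coordinates of `W` leaves a single sum
over k. -/
theorem integral_simpleIntegral_mul_conj (hW : IsGaussianRandomMeasure W P)
    {s s' : SimpleFunc (Vec ℝ m) (Mat 𝕜 n)} (hs : FinMeasSupport s) (hs' : FinMeasSupport s')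
    (i j : Fin n) :
    ∫ ω, simpleIntegral W s ω i * starRingEnd 𝕜 (simpleIntegral W s' ω j) ∂P =
      ∑ k, ∫ x, s x i k * starRingEnd 𝕜 (s' x j k) := by
  classical
  set R := s.range.filter (· ≠ 0) with hR
  set R' := s'.range.filter (· ≠ 0) with hR'
  have hfin : ∀ M ∈ R, volume (s ⁻¹' {M}) < ⊤ := fun M hM => hs M (Finset.mem_filter.1 hM).2
  have hfin' : ∀ M ∈ R', volume (s' ⁻¹' {M}) < ⊤ := fun M hM => hs' M (Finset.mem_filter.1 hM).2
  have hL : ∫ ω, simpleIntegral W s ω i * starRingEnd 𝕜 (simpleIntegral W s' ω j) ∂P =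
      ∑ M ∈ R, ∑ M' ∈ R', ∑ k, M i k * starRingEnd 𝕜 (M' j k) *
        (((volume (s ⁻¹' {M} ∩ s' ⁻¹' {M'})).toReal : ℝ) : 𝕜) := by
    have h1 : ∀ ω, simpleIntegral W s ω i * starRingEnd 𝕜 (simpleIntegral W s' ω j) =
        ∑ p ∈ R ×ˢ (Finset.univ : Finset (Fin n)), ∑ q ∈ R' ×ˢ (Finset.univ : Finset (Fin n)),
          (p.1 i p.2 * starRingEnd 𝕜 (q.1 j q.2)) *
            (W (s ⁻¹' {p.1}) ω p.2 * starRingEnd 𝕜 (W (s' ⁻¹' {q.1}) ω q.2)) := fun ω => by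
      rw [simpleIntegral_apply, simpleIntegral_apply, map_sum, Finset.sum_mul_sum]
      refine Finset.sum_congr rfl fun p _ => Finset.sum_congr rfl fun q _ => ?_
      rw [map_mul]; ring
    simp_rw [h1]
    have hint : ∀ p ∈ R ×ˢ (Finset.univ : Finset (Fin n)),
        ∀ q ∈ R' ×ˢ (Finset.univ : Finset (Fin n)), Integrable (fun ω =>
          (p.1 i p.2 * starRingEnd 𝕜 (q.1 j q.2)) *
            (W (s ⁻¹' {p.1}) ω p.2 * starRingEnd 𝕜 (W (s' ⁻¹' {q.1}) ω q.2))) P :=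
      fun p hp q hq => (integrable_mul_conj
        (hW.memLp (s.measurableSet_preimage _) (hfin _ (Finset.mem_product.1 hp).1) _)
        (hW.memLp (s'.measurableSet_preimage _) (hfin' _ (Finset.mem_product.1 hq).1) _)).const_mul _
    rw [integral_finsetSum _ fun p hp => integrable_finsetSum _ fun q hq => hint p hp q hq,
      Finset.sum_product]
    refine Finset.sum_congr rfl fun M hM => ?_
    rw [Finset.sum_comm]
    have : ∀ k : Fin n, ∫ ω, ∑ q ∈ R' ×ˢ (Finset.univ : Finset (Fin n)),
          (M i k * starRingEnd 𝕜 (q.1 j q.2)) *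
            (W (s ⁻¹' {M}) ω k * starRingEnd 𝕜 (W (s' ⁻¹' {q.1}) ω q.2)) ∂P =
        ∑ M' ∈ R', M i k * starRingEnd 𝕜 (M' j k) *
        (((volume (s ⁻¹' {M} ∩ s' ⁻¹' {M'})).toReal : ℝ) : 𝕜) := fun k => by
      rw [integral_finsetSum _ fun q hq => hint (M, k) (by simp [hM]) q hq, Finset.sum_product]
      refine Finset.sum_congr rfl fun M' hM' => ?_
      simp_rw [integral_const_mul]
      simp_rw [hW.covariance _ _ (s.measurableSet_preimage _) (hfin M hM)
        (s'.measurableSet_preimage _) (hfin' M' hM')]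
      simp
    rw [Finset.sum_congr rfl fun k _ => this k, Finset.sum_comm]
  have hRt : ∀ k, ∫ x, s x i k * starRingEnd 𝕜 (s' x j k) =
      ∑ M ∈ R, ∑ M' ∈ R', M i k * starRingEnd 𝕜 (M' j k) *
        (((volume (s ⁻¹' {M} ∩ s' ⁻¹' {M'})).toReal : ℝ) : 𝕜) := fun k => by
    have h1 : ∀ x, s x i k * starRingEnd 𝕜 (s' x j k) = ∑ M ∈ R, ∑ M' ∈ R',
        (s ⁻¹' {M} ∩ s' ⁻¹' {M'}).indicator (fun _ => M i k * starRingEnd 𝕜 (M' j k)) x :=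
      fun x => by
        rw [simpleFunc_apply s, simpleFunc_apply s', map_sum, Finset.sum_mul_sum]
        refine Finset.sum_congr rfl fun M _ => Finset.sum_congr rfl fun M' _ => ?_
        by_cases h : x ∈ s ⁻¹' {M} <;> by_cases h' : x ∈ s' ⁻¹' {M'} <;>
          simp only [Set.indicator, Set.mem_inter_iff, h, h', if_true, if_false, and_self,
            and_true, and_false, map_zero, mul_zero, zero_mul]
    have hms : ∀ M M', MeasurableSet (s ⁻¹' {M} ∩ s' ⁻¹' {M'}) := fun M M' =>
      (s.measurableSet_preimage _).inter (s'.measurableSet_preimage _)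
    have hint : ∀ M ∈ R, ∀ M' ∈ R', Integrable (fun x => (s ⁻¹' {M} ∩ s' ⁻¹' {M'}).indicator
        (fun _ => M i k * starRingEnd 𝕜 (M' j k)) x) :=
      fun M hM M' _ => (integrable_indicator_iff (hms M M')).2 (integrableOn_const
        (measure_mono Set.inter_subset_left |>.trans_lt (hfin M hM)).ne)
    simp_rw [h1]
    rw [integral_finsetSum _ fun M hM => integrable_finsetSum _ fun M' hM' => hint M hM M' hM']
    refine Finset.sum_congr rfl fun M hM => ?_
    rw [integral_finsetSum _ fun M' hM' => hint M hM M' hM']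
    refine Finset.sum_congr rfl fun M' hM' => ?_
    rw [integral_indicator (hms M M'), setIntegral_const, RCLike.real_smul_eq_coe_mul, mul_comm]
    rfl
  rw [hL, Finset.sum_congr rfl fun k _ => hRt k]
  rw [Finset.sum_comm]
  refine Eq.trans ?_ (Finset.sum_comm)
  rw [Finset.sum_comm]
  refine Finset.sum_congr rfl fun M _ => ?_
  rw [Finset.sum_comm]

theorem eLpNorm_eval_le {ι : Type*} [Fintype ι] {α : Type*} [MeasurableSpace α] {μ : Measure α}
    (f : α → EuclideanSpace 𝕜 ι) (i : ι) :
    eLpNorm (fun x => f x i) 2 μ ≤ eLpNorm f 2 μ :=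
  eLpNorm_mono fun x => PiLp.norm_apply_le (f x) i

theorem IsStochasticIntegral.memLp {K : Vec ℝ m → Mat 𝕜 n} {Y : Ω → Vec 𝕜 n}
    (h : IsStochasticIntegral W P K Y) (i : Fin n) : MemLp (fun ω => Y ω i) 2 P :=
  h.2.1.eval_piLp i

theorem tendsto_eLpNorm_eval {Y : Ω → Vec 𝕜 n} {s : ℕ → SimpleFunc (Vec ℝ m) (Mat 𝕜 n)}
    (h : Tendsto (fun k => eLpNorm (fun ω => simpleIntegral W (s k) ω - Y ω) 2 P) atTop (𝓝 0))
    (i : Fin n) :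
    Tendsto (fun k => eLpNorm (fun ω => simpleIntegral W (s k) ω i - Y ω i) 2 P) atTop (𝓝 0) :=
  tendsto_of_tendsto_of_tendsto_of_le_of_le tendsto_const_nhds h (fun _ => zero_le) fun k =>
    eLpNorm_eval_le (fun ω => simpleIntegral W (s k) ω - Y ω) i

/-- The isometry property of the stochastic integral. -/
theorem IsStochasticIntegral.integral_mul_conj (hW : IsGaussianRandomMeasure W P)
    {K K' : Vec ℝ m → Mat 𝕜 n} {Y Y' : Ω → Vec 𝕜 n} (h : IsStochasticIntegral W P K Y)
    (h' : IsStochasticIntegral W P K' Y') (i j : Fin n) :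
    ∫ ω, Y ω i * starRingEnd 𝕜 (Y' ω j) ∂P = ∑ k, ∫ x, K x i k * starRingEnd 𝕜 (K' x j k) := by
  obtain ⟨s, hs, hsK, hsY⟩ := h.2.2
  obtain ⟨s', hs', hsK', hsY'⟩ := h'.2.2
  have h1 := tendsto_integral_mul_conj (fun k => simpleIntegral_memLp hW (hs k) i) (h.memLp i)
    (fun k => simpleIntegral_memLp hW (hs' k) j) (h'.memLp j) (tendsto_eLpNorm_eval hsY i)
    (tendsto_eLpNorm_eval hsY' j)
  have h2 := tendsto_finsetSum Finset.univ fun k (_ : k ∈ Finset.univ) =>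
    tendsto_integral_mul_conj (fun l => simpleFunc_memLp (hs l) i k) (h.1 i k)
      (fun l => simpleFunc_memLp (hs' l) j k) (h'.1 j k) (hsK i k) (hsK' j k)
  refine tendsto_nhds_unique h1 (h2.congr fun l => ?_)
  exact (integral_simpleIntegral_mul_conj hW (hs l) (hs' l) i j).symm

/-- Mutual distances are determined by the Gram matrix. This transfers the Cauchy property from
kernels to their integrals. -/
theorem cauchySeq_of_inner_eq {E F : Type*} [NormedAddCommGroup E] [InnerProductSpace 𝕜 E]
    [NormedAddCommGroup F] [InnerProductSpace 𝕜 F] {a : ℕ → E} {b : ℕ → F}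
    (h : ∀ k l, inner 𝕜 (a k) (a l) = inner 𝕜 (b k) (b l)) (hb : CauchySeq b) : CauchySeq a := by
  have hn : ∀ k l, ‖a k - a l‖ = ‖b k - b l‖ := fun k l => by
    have : ‖a k - a l‖ ^ 2 = ‖b k - b l‖ ^ 2 := by
      rw [← @inner_self_eq_norm_sq 𝕜, ← @inner_self_eq_norm_sq 𝕜]
      simp only [inner_sub_left, inner_sub_right, h]
    exact (pow_left_inj₀ (norm_nonneg _) (norm_nonneg _) two_ne_zero).1 this
  rw [Metric.cauchySeq_iff] at hb ⊢
  simpa only [dist_eq_norm, hn] using hb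

theorem exists_simpleFunc_tendsto {K : Vec ℝ m → Mat 𝕜 n}
    (hK : ∀ i j, MemLp (fun x => K x i j) 2 volume) :
    ∃ s : ℕ → SimpleFunc (Vec ℝ m) (Mat 𝕜 n), (∀ k, FinMeasSupport (s k)) ∧
      ∀ i j, Tendsto (fun k => eLpNorm (fun x => s k x i j - K x i j) 2 volume) atTop (𝓝 0) := by
  -- Matrices are read in an iterated product, whose sup norm dominates every entry.
  let K₁ : Vec ℝ m → Fin n → Fin n → 𝕜 := K
  have hK' : MemLp (ε := Fin n → Fin n → 𝕜) K₁ 2 volume :=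
    MemLp.of_eval fun i => MemLp.of_eval fun j => hK i j
  choose s hs using fun k : ℕ => hK'.exists_simpleFunc_eLpNorm_sub_lt (by simp)
    (ε := ((k : ENNReal) + 1)⁻¹) (by simp)
  refine ⟨s, fun k M hM => (s k).measure_preimage_lt_top_of_memLp two_ne_zero (by simp) (hs k).2 M hM,
    fun i j => ?_⟩
  refine tendsto_of_tendsto_of_tendsto_of_le_of_le tendsto_const_nhds
    (ENNReal.tendsto_inv_nat_nhds_zero.comp (tendsto_add_atTop_nat 1)) (fun _ => zero_le) fun k => ?_
  refine le_trans ?_ ((hs k).1.le.trans (by simp))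
  refine eLpNorm_mono fun x => ?_
  rw [norm_sub_rev]
  exact (norm_le_pi_norm ((K₁ - s k : Vec ℝ m → Fin n → Fin n → 𝕜) x i) j).trans
    (norm_le_pi_norm ((K₁ - s k : Vec ℝ m → Fin n → Fin n → 𝕜) x) i)

theorem euclideanSpace_norm_le_sum {ι : Type*} [Fintype ι] (v : EuclideanSpace 𝕜 ι) :
    ‖v‖ ≤ ∑ i, ‖v i‖ := by
  classical
  have h : v = ∑ i, EuclideanSpace.single i (v i) := by
    ext j
    simp [Finset.sum_apply, Pi.single_apply]
  conv_lhs => rw [h]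
  exact (norm_sum_le _ _).trans (by simp)

theorem exists_isStochasticIntegral (hW : IsGaussianRandomMeasure W P)
    {K : Vec ℝ m → Mat 𝕜 n} (hK : ∀ i j, MemLp (fun x => K x i j) 2 volume) :
    ∃ Y, IsStochasticIntegral W P K Y := by
  obtain ⟨s, hs, hsK⟩ := exists_simpleFunc_tendsto hK
  have key : ∀ i, ∃ y : Lp 𝕜 2 P,
      Tendsto (fun k => (simpleIntegral_memLp hW (hs k) i).toLp) atTop (𝓝 y) := fun i => by
    -- Coordinate i of the integral depends on row i of the kernel alone; `b k` is that row in the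
    -- Hilbert sum of n copies of L², and the isometry matches the Gram matrices.
    let b : ℕ → PiLp 2 (fun _ : Fin n => Lp 𝕜 2 (volume : Measure (Vec ℝ m))) := fun k =>
      WithLp.toLp 2 fun j => (simpleFunc_memLp (hs k) i j).toLp
    refine cauchySeq_tendsto_of_complete (cauchySeq_of_inner_eq (𝕜 := 𝕜) (b := b) (fun k l => ?_) ?_)
    · rw [PiLp.inner_apply, inner_toLp_eq_integral, integral_simpleIntegral_mul_conj hW (hs l) (hs k)]
      refine Finset.sum_congr rfl fun j _ => ?_
      exact (inner_toLp_eq_integral (simpleFunc_memLp (hs l) i j) (simpleFunc_memLp (hs k) i j)).symm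
    · refine Tendsto.cauchySeq (x := WithLp.toLp 2 fun j => (hK i j).toLp) ?_
      refine ((PiLp.continuous_toLp 2 _).tendsto _).comp (tendsto_pi_nhds.2 fun j => ?_)
      exact (Lp.tendsto_Lp_iff_tendsto_eLpNorm'' _ _ _ (hK i j)).2 (hsK i j)
  choose y hy using key
  refine ⟨fun ω => WithLp.toLp 2 fun i => y i ω, hK, MemLp.of_eval_piLp fun i => Lp.memLp (y i),
    s, hs, hsK, ?_⟩
  have h0 : ∀ i, Tendsto (fun k => eLpNorm (fun ω => simpleIntegral W (s k) ω i - y i ω) 2 P) atTop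
      (𝓝 0) := fun i => by
    have := (Lp.tendsto_Lp_iff_tendsto_eLpNorm'' _ (fun k => simpleIntegral_memLp hW (hs k) i) _
      (Lp.memLp (y i))).1 (by simpa using hy i)
    exact this
  have h1 := tendsto_finsetSum Finset.univ fun i (_ : i ∈ Finset.univ) => h0 i
  rw [Finset.sum_const_zero] at h1
  refine tendsto_of_tendsto_of_tendsto_of_le_of_le tendsto_const_nhds h1 (fun _ => zero_le) fun k => ?_
  have hm : ∀ i, MemLp (fun ω => simpleIntegral W (s k) ω i - y i ω) 2 P := fun i =>
    (simpleIntegral_memLp hW (hs k) i).sub (Lp.memLp (y i))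
  calc _ ≤ eLpNorm (∑ i, fun ω => ‖simpleIntegral W (s k) ω i - y i ω‖) 2 P := by
        refine eLpNorm_mono fun ω => ?_
        rw [Finset.sum_apply, Real.norm_of_nonneg (Finset.sum_nonneg fun _ _ => norm_nonneg _)]
        exact euclideanSpace_norm_le_sum (simpleIntegral W (s k) ω - WithLp.toLp 2 fun i => y i ω)
    _ ≤ ∑ i, eLpNorm (fun ω => ‖simpleIntegral W (s k) ω i - y i ω‖) 2 P :=
        eLpNorm_sum_le (fun i _ => (hm i).1.norm) one_le_two
    _ = _ := Finset.sum_congr rfl fun i _ => eLpNorm_norm _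

end StochasticIntegral

/-! ### Moving averages against a real random measure. -/

section RealNoise

variable {m n : ℕ} {Ω : Type*} [MeasurableSpace Ω] {P : Measure Ω}
  {W : Set (Vec ℝ m) → Ω → Vec ℝ n}

/-- The linear span of the coordinates of a random measure. -/
def noiseSpace (W : Set (Vec ℝ m) → Ω → Vec ℝ n) : Submodule ℝ (Ω → ℝ) :=
  Submodule.span ℝ (Set.range fun (p : {A : Set (Vec ℝ m) // MeasurableSet A ∧ volume A < ⊤} × Fin n)
    ω => W p.1 ω p.2)

theorem integral_euclideanSpace_apply {X : Ω → Vec ℝ n} (hX : Integrable X P) (i : Fin n) :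
    ∫ ω, X ω i ∂P = (∫ ω, X ω ∂P) i :=
  (EuclideanSpace.proj i : Vec ℝ n →L[ℝ] ℝ).integral_comp_comm hX

theorem IsGaussianRandomMeasure.isGaussianSpace (hW : IsGaussianRandomMeasure W P) :
    IsGaussianSpace (noiseSpace W) P := by
  refine IsGaussianProcess.isGaussianSpace_span ?_ fun p => ?_
  · refine hW.gaussian.of_isGaussianProcess fun p => ⟨{p.1},
      (EuclideanSpace.proj p.2 : Vec ℝ n →L[ℝ] ℝ).comp
        (ContinuousLinearMap.proj ⟨p.1, Finset.mem_singleton_self _⟩), fun ω => rfl⟩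
  · have h : HasGaussianLaw (W p.1) P := hW.gaussian.hasGaussianLaw_eval p.1
    rw [integral_euclideanSpace_apply h.integrable, hW.mean_zero _ p.1.2.1 p.1.2.2]
    rfl

/-- Placing all integrals in one Gaussian space makes any family of them jointly Gaussian and
centred. -/
theorem IsStochasticIntegral.mem_limitSpace (hW : IsGaussianRandomMeasure W P)
    {K : Vec ℝ m → Mat ℝ n} {Y : Ω → Vec ℝ n} (h : IsStochasticIntegral W P K Y) (i : Fin n) :
    (fun ω => Y ω i) ∈ limitSpace (noiseSpace W) P hW.isGaussianSpace.memLp := by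
  classical
  obtain ⟨s, hs, -, hsY⟩ := h.2.2
  refine ⟨h.memLp i, fun k ω => simpleIntegral W (s k) ω i, fun k => ?_, tendsto_eLpNorm_eval hsY i⟩
  have : (fun ω => simpleIntegral W (s k) ω i) =
      ∑ p ∈ ((s k).range.filter (· ≠ 0)) ×ˢ (Finset.univ : Finset (Fin n)),
        p.1 i p.2 • fun ω => W (s k ⁻¹' {p.1}) ω p.2 := by
    ext ω
    simp [simpleIntegral_apply]
  show (fun ω => simpleIntegral W (s k) ω i) ∈ _
  rw [this]
  refine Submodule.sum_mem _ fun p hp => Submodule.smul_mem _ _ (Submodule.subset_span ?_)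
  exact ⟨(⟨s k ⁻¹' {p.1}, (s k).measurableSet_preimage _,
    hs k _ (Finset.mem_filter.1 (Finset.mem_product.1 hp).1).2⟩, p.2), rfl⟩

/-- A centred Gaussian field with the covariances of a moving average has a moving average
representation with respect to every Gaussian random measure. -/
theorem hasMovingAverageRepr_of_covariance {Ω' : Type*} [MeasurableSpace Ω'] {P' : Measure Ω'}
    [IsProbabilityMeasure P]
    {X : Vec ℝ m → Ω' → Vec ℝ n} (hX : IsGaussianProcess X P') (hX0 : ∀ t, ∫ ω, X t ω ∂P' = 0)
    {φ : Vec ℝ m → Mat ℝ n}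
    (hφ : ∀ t i j, MemLp (fun u => φ (t - u) i j - φ (-u) i j) 2 volume)
    (hcov : ∀ s t i j, ∫ ω, X s ω i * X t ω j ∂P' =
      ∑ k, ∫ u, (φ (s - u) i k - φ (-u) i k) * (φ (t - u) j k - φ (-u) j k))
    (hW : IsGaussianRandomMeasure W P) : HasMovingAverageRepr X P' φ W P := by
  choose Y hY using fun t => exists_isStochasticIntegral hW (K := fun u => φ (t - u) - φ (-u)) (hφ t)
  have hS := hW.isGaussianSpace.limitSpace
  have hmem := fun t => (hY t).mem_limitSpace hW
  refine ⟨Y, hY, sameFDD_of_covariance_eq hX (hS.isGaussianProcess hmem) hX0 (fun t => ?_) ?_⟩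
  · ext i
    rw [← integral_euclideanSpace_apply ((hY t).2.1.integrable one_le_two)]
    exact (hS _ (hmem t i)).2
  · intro s t i j
    rw [hcov]
    have := (hY s).integral_mul_conj hW (hY t) i j
    simp only [conj_trivial] at this
    rw [this]
    rfl

end RealNoise

/-! ### Hermitian random measures: a real integral has a Hermitian kernel. -/

section HermitianNoise

variable {m n : ℕ} {Ω : Type*} [MeasurableSpace Ω] {P : Measure Ω}
  {W : Set (Vec ℝ m) → Ω → Vec ℂ n}

/-- The simple function `x ↦ conj (s (-x))`. -/
def conjReflect (s : SimpleFunc (Vec ℝ m) (Mat ℂ n)) : SimpleFunc (Vec ℝ m) (Mat ℂ n) :=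
  (s.comp Neg.neg measurable_neg).map fun M => M.map (starRingEnd ℂ)

theorem conjReflect_apply (s : SimpleFunc (Vec ℝ m) (Mat ℂ n)) (x : Vec ℝ m) (i j : Fin n) :
    conjReflect s x i j = starRingEnd ℂ (s (-x) i j) := rfl

theorem matrix_map_conj_involutive :
    Function.Involutive fun M : Mat ℂ n => M.map (starRingEnd ℂ) := fun M => by
  ext i j; simp

theorem conjReflect_preimage (s : SimpleFunc (Vec ℝ m) (Mat ℂ n)) (M : Mat ℂ n) :
    conjReflect s ⁻¹' {M.map (starRingEnd ℂ)} = Neg.neg ⁻¹' (s ⁻¹' {M}) := by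
  ext x
  simp only [conjReflect, SimpleFunc.coe_map, SimpleFunc.coe_comp, Set.mem_preimage,
    Function.comp_apply, Set.mem_singleton_iff]
  exact matrix_map_conj_involutive.injective.eq_iff

theorem FinMeasSupport.conjReflect {s : SimpleFunc (Vec ℝ m) (Mat ℂ n)} (hs : FinMeasSupport s) :
    FinMeasSupport (conjReflect s) := by
  intro M hM
  obtain ⟨N, rfl⟩ := matrix_map_conj_involutive.surjective M
  rw [conjReflect_preimage, Measure.measure_preimage_neg]
  exact hs N fun h => hM (by rw [h]; ext; simp)

/-- The reflected function takes the value conj M on the negative of the level set of M, and there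
the noise is the conjugate one. The null sets are harmless because there are finitely many values.
-/
theorem simpleIntegral_conjReflect (hW : IsHermitianMeasure W P)
    {s : SimpleFunc (Vec ℝ m) (Mat ℂ n)} (hs : FinMeasSupport s) :
    ∀ᵐ ω ∂P, ∀ i, simpleIntegral W (conjReflect s) ω i = starRingEnd ℂ (simpleIntegral W s ω i) := by
  classical
  have h1 : ∀ᵐ ω ∂P, ∀ M ∈ s.range, M ≠ 0 → ∀ i,
      W (Neg.neg ⁻¹' (s ⁻¹' {M})) ω i = starRingEnd ℂ (W (s ⁻¹' {M}) ω i) := by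
    rw [eventually_all_finset]
    intro M _
    by_cases hM : M = 0
    · exact ae_of_all _ fun ω h => absurd hM h
    · filter_upwards [hW _ (s.measurableSet_preimage {M}) (hs M hM)] with ω hω _ using hω
  have hr : (conjReflect s).range = s.range.image fun M => M.map (starRingEnd ℂ) := by
    ext M
    simp only [SimpleFunc.mem_range, Finset.mem_image, Set.mem_range]
    constructor
    · rintro ⟨x, rfl⟩
      exact ⟨s (-x), ⟨-x, rfl⟩, rfl⟩
    · rintro ⟨_, ⟨x, rfl⟩, rfl⟩
      exact ⟨-x, by ext i j; simp [conjReflect_apply]⟩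
  filter_upwards [h1] with ω hω i
  rw [simpleIntegral_apply, simpleIntegral_apply, Finset.sum_product, Finset.sum_product, map_sum, hr,
    Finset.sum_filter, Finset.sum_image matrix_map_conj_involutive.injective.injOn, Finset.sum_filter]
  refine Finset.sum_congr rfl fun M hM => ?_
  have hz : M.map (starRingEnd ℂ) ≠ 0 ↔ M ≠ 0 := by
    rw [← matrix_map_conj_involutive.injective.ne_iff (x := M) (y := 0)]
    have : (0 : Mat ℂ n).map (starRingEnd ℂ) = 0 := by ext; simp
    simp [this]
  by_cases h : M = 0
  · simp [h]
  · rw [if_pos (hz.2 h), if_pos h, map_sum]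
    refine Finset.sum_congr rfl fun k _ => ?_
    rw [conjReflect_preimage, hω M hM h k, map_mul]
    rfl

/-- Conjugate and reflect the approximating simple kernels: their integrals converge to conj Y,
which is Y. -/
theorem IsStochasticIntegral.conjReflect
    (hW' : IsHermitianMeasure W P) {K : Vec ℝ m → Mat ℂ n} {Y : Ω → Vec ℂ n}
    (h : IsStochasticIntegral W P K Y) (hreal : ∀ᵐ ω ∂P, ∀ i, starRingEnd ℂ (Y ω i) = Y ω i) :
    IsStochasticIntegral W P (fun x => (K (-x)).map (starRingEnd ℂ)) Y := by
  obtain ⟨s, hs, hsK, hsY⟩ := h.2.2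
  refine ⟨fun i j => ?_, h.2.1, fun k => OFBF.conjReflect (s k),
    fun k => FinMeasSupport.conjReflect (s := s k) (hs k),
    fun i j => ?_, ?_⟩
  · exact ((h.1 i j).comp_measurePreserving (Measure.measurePreserving_neg volume)).star
  · refine (hsK i j).congr fun k => ?_
    have hm : AEStronglyMeasurable (fun x => s k x i j - K x i j) volume :=
      ((simpleFunc_memLp (hs k) i j).sub (h.1 i j)).1
    rw [← eLpNorm_comp_measurePreserving hm (Measure.measurePreserving_neg volume)]
    refine eLpNorm_congr_norm_ae (ae_of_all _ fun x => ?_)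
    simp only [Function.comp_apply, conjReflect_apply, Matrix.map_apply]
    rw [← map_sub, RCLike.norm_conj]
  · refine hsY.congr fun k => ?_
    refine eLpNorm_congr_norm_ae ?_
    filter_upwards [hreal, simpleIntegral_conjReflect hW' (hs k)] with ω h1 h2
    rw [EuclideanSpace.norm_eq, EuclideanSpace.norm_eq]
    congr 1
    refine Finset.sum_congr rfl fun i _ => ?_
    simp only [PiLp.sub_apply]
    rw [h2 i, ← h1 i, ← map_sub, RCLike.norm_conj, h1 i]

theorem integral_mul_conj_self_eq {α : Type*} [MeasurableSpace α] {μ : Measure α} (f : α → ℂ) :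
    ∫ x, f x * starRingEnd ℂ (f x) ∂μ = ((∫ x, ‖f x‖ ^ 2 ∂μ : ℝ) : ℂ) := by
  rw [← integral_complex_ofReal]
  congr 1 with x
  rw [Complex.mul_conj, Complex.normSq_eq_norm_sq]

/-- If the stochastic integral of a kernel against a Hermitian random measure is real, then the
kernel is Hermitian. -/
theorem IsStochasticIntegral.kernel_hermitian (hW : IsGaussianRandomMeasure W P)
    (hW' : IsHermitianMeasure W P) {K : Vec ℝ m → Mat ℂ n} {Y : Ω → Vec ℂ n}
    (h : IsStochasticIntegral W P K Y) (hreal : ∀ᵐ ω ∂P, ∀ i, starRingEnd ℂ (Y ω i) = Y ω i)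
    (i j : Fin n) : ∀ᵐ x, K x i j = starRingEnd ℂ (K (-x) i j) := by
  have h' := h.conjReflect hW' hreal
  have e1 := h.integral_mul_conj hW h i i
  have e2 := h.integral_mul_conj hW h' i i
  have e3 := h'.integral_mul_conj hW h i i
  have e4 := h'.integral_mul_conj hW h' i i
  simp only [Matrix.map_apply] at e2 e3 e4
  have hK : ∀ k, MemLp (fun x => starRingEnd ℂ (K (-x) i k)) 2 volume := fun k => h'.1 i k
  -- The kernel and its reflected conjugate both integrate to `Y`, so in the expanded squared
  -- distance between their rows all four inner products equal E|Y_i|² and cancel.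
  have hsum : ∑ k, ∫ x, (K x i k - starRingEnd ℂ (K (-x) i k)) *
      starRingEnd ℂ (K x i k - starRingEnd ℂ (K (-x) i k)) = 0 := by
    refine (Finset.sum_congr rfl fun k _ => integral_sub_mul_conj (h.1 i k) (hK k)).trans ?_
    rw [Finset.sum_add_distrib, Finset.sum_sub_distrib, Finset.sum_sub_distrib, ← e1, ← e2, ← e3,
      ← e4]
    ring
  simp_rw [integral_mul_conj_self_eq] at hsum
  rw [← Complex.ofReal_sum, Complex.ofReal_eq_zero,
    Finset.sum_eq_zero_iff_of_nonneg fun k _ => integral_nonneg fun x => by positivity] at hsum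
  refine ae_eq_of_integral_sub_mul_conj (h.1 i j) (hK j) ?_
  refine (integral_mul_conj_self_eq _).trans ?_
  exact (congrArg _ (hsum j (Finset.mem_univ j))).trans Complex.ofReal_zero

end HermitianNoise

/-! ### Covariance and Hermitian symmetry from the harmonizable representation. -/

section Harmonizable

variable {m n : ℕ} {Ω Ω' : Type*} [MeasurableSpace Ω] [MeasurableSpace Ω'] {P : Measure Ω}
  {P' : Measure Ω'} {W : Set (Vec ℝ m) → Ω' → Vec ℂ n} {X : Vec ℝ m → Ω → Vec ℝ n}
  {g : Vec ℝ m → Mat ℂ n}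

/-- The kernel of the harmonizable representation. -/
def harmonizableKernel (g : Vec ℝ m → Mat ℂ n) (t x : Vec ℝ m) : Mat ℂ n :=
  (Complex.exp (Complex.I * (inner ℝ x t : ℝ)) - 1) • g x

theorem HasHarmonizableRepr.memLp (h : HasHarmonizableRepr X P g W P') (t : Vec ℝ m) (i j : Fin n) :
    MemLp (fun x => harmonizableKernel g t x i j) 2 volume := by
  obtain ⟨Y, hY, -⟩ := h
  exact (hY t).1 i j

theorem HasHarmonizableRepr.covariance (hW : IsGaussianRandomMeasure W P')
    (h : HasHarmonizableRepr X P g W P') (s t : Vec ℝ m) (i j : Fin n) :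
    ((∫ ω, X s ω i * X t ω j ∂P : ℝ) : ℂ) = ∑ k, ∫ x, harmonizableKernel g s x i k *
      starRingEnd ℂ (harmonizableKernel g t x j k) := by
  classical
  obtain ⟨Y, hY, hXY⟩ := h
  have h1 := hXY {s, t}
  have hm : Measurable fun x : (({s, t} : Finset (Vec ℝ m)) → Vec ℂ n) =>
      x ⟨s, by simp⟩ i * starRingEnd ℂ (x ⟨t, by simp⟩ j) := by
    refine Measurable.mul ?_ ?_
    · exact ((EuclideanSpace.proj i : Vec ℂ n →L[ℂ] ℂ).continuous.measurable).comp (measurable_pi_apply _)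
    · exact Complex.continuous_conj.measurable.comp
        (((EuclideanSpace.proj j : Vec ℂ n →L[ℂ] ℂ).continuous.measurable).comp (measurable_pi_apply _))
  have h2 := (h1.comp hm).integral_eq
  have h3 := (hY s).integral_mul_conj hW (hY t) i j
  simp only [Function.comp_def] at h2
  rw [h3] at h2
  rw [← integral_complex_ofReal]
  refine Eq.trans ?_ h2
  congr 1 with ω
  simp

theorem HasHarmonizableRepr.kernel_hermitian (hW : IsGaussianRandomMeasure W P')
    (hW' : IsHermitianMeasure W P') (h : HasHarmonizableRepr X P g W P') (t : Vec ℝ m)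
    (i j : Fin n) :
    ∀ᵐ x, harmonizableKernel g t x i j = starRingEnd ℂ (harmonizableKernel g t (-x) i j) := by
  obtain ⟨Y, hY, hXY⟩ := h
  refine (hY t).kernel_hermitian hW hW' ?_ i j
  have h1 := hXY {t}
  have hm : MeasurableSet {x : (({t} : Finset (Vec ℝ m)) → Vec ℂ n) |
      ∀ i, starRingEnd ℂ (x ⟨t, by simp⟩ i) = x ⟨t, by simp⟩ i} := by
    rw [Set.ofPred_forall]
    refine MeasurableSet.iInter fun i => ?_
    have h0 : Measurable fun x : (({t} : Finset (Vec ℝ m)) → Vec ℂ n) => x ⟨t, by simp⟩ i :=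
      ((EuclideanSpace.proj i : Vec ℂ n →L[ℂ] ℂ).continuous.measurable).comp (measurable_pi_apply _)
    exact measurableSet_eq_fun (Complex.continuous_conj.measurable.comp h0) h0
  exact h1.ae_snd (p := fun x => ∀ i, starRingEnd ℂ (x ⟨t, by simp⟩ i) = x ⟨t, by simp⟩ i) hm
    (ae_of_all _ fun ω i => by simp)

end Harmonizable

/-! ### Existence of Gaussian random measures. -/

section Existence

theorem orthonormal_infinitePi_gaussian (ι : Type*) :
    Orthonormal ℝ fun i : ι => (show MemLp (fun ω : ι → ℝ => ω i) 2
      (Measure.infinitePi fun _ => gaussianReal 0 1) from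
        (memLp_id_gaussianReal 2).comp_measurePreserving
          (measurePreserving_eval_infinitePi (fun _ : ι => gaussianReal 0 1) i)).toLp := by
  classical
  have hint : ∀ (i : ι) (f : ℝ → ℝ), Measurable f →
      ∫ ω, f (ω i) ∂(Measure.infinitePi fun _ : ι => gaussianReal 0 1) =
      ∫ x, f x ∂(gaussianReal 0 1) := fun i f hf => by
    have hp := measurePreserving_eval_infinitePi (fun _ : ι => gaussianReal 0 1) i
    have h := integral_map (μ := Measure.infinitePi fun _ : ι => gaussianReal 0 1)
      (φ := Function.eval i) (measurable_pi_apply i).aemeasurable (f := f) hf.aestronglyMeasurable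
    rw [hp.map_eq] at h
    exact h.symm
  rw [orthonormal_iff_ite]
  intro i j
  rw [inner_toLp_eq_integral]
  simp only [conj_trivial]
  split_ifs with hij
  · subst hij
    rw [hint i (fun x => x * x) (by fun_prop)]
    have h1 : Var[id; gaussianReal 0 1] = 1 := by simp
    rw [variance_of_integral_eq_zero (by fun_prop) (by simp)] at h1
    simpa [pow_two] using h1
  · have hind := (iIndepFun_infinitePi (P := fun _ : ι => gaussianReal 0 1)
      (X := fun _ x => x) fun _ => measurable_id).indepFun hij
    have := hind.symm.integral_fun_mul_eq_mul_integral
      (measurable_pi_apply j).aestronglyMeasurable (measurable_pi_apply i).aestronglyMeasurable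
    rw [this, hint i (fun x => x) measurable_id]
    simp

/-- The isonormal Gaussian process: a Gaussian space isometric to a given Hilbert space. -/
theorem exists_isonormal (V : Type) [NormedAddCommGroup V] [InnerProductSpace ℝ V]
    [CompleteSpace V] :
    ∃ (Ω : Type) (_ : MeasurableSpace Ω) (P : Measure Ω) (_ : IsProbabilityMeasure P)
      (J : V →ₗᵢ[ℝ] Lp ℝ 2 P) (S : Submodule ℝ (Ω → ℝ)), IsGaussianSpace S P ∧
        ∀ v, (J v : Ω → ℝ) ∈ S := by
  classical
  obtain ⟨w, b, -⟩ := exists_hilbertBasis ℝ V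
  let P : Measure (w → ℝ) := Measure.infinitePi fun _ => gaussianReal 0 1
  have hξ : ∀ i : w, MemLp (fun ω : w → ℝ => ω i) 2 P := fun i =>
    (memLp_id_gaussianReal 2).comp_measurePreserving
          (measurePreserving_eval_infinitePi (fun _ : w => gaussianReal 0 1) i)
  have ho : Orthonormal ℝ fun i : w => (hξ i).toLp := orthonormal_infinitePi_gaussian w
  let S₀ : Submodule ℝ ((w → ℝ) → ℝ) := Submodule.span ℝ (Set.range fun (i : w) ω => ω i)
  have hS₀ : IsGaussianSpace S₀ P := by
    refine IsGaussianProcess.isGaussianSpace_span (Z := fun (i : w) (ω : w → ℝ) => ω i) ⟨fun I => ?_⟩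
      fun i => ?_
    · have hind := (iIndepFun_infinitePi (P := fun _ : w => gaussianReal 0 1)
        (X := fun _ x => x) fun _ => measurable_id).precomp (Subtype.val_injective (p := (· ∈ I)))
      refine iIndepFun.hasGaussianLaw (fun i => ?_) hind
      refine ⟨?_⟩
      have := (measurePreserving_eval_infinitePi (fun _ : w => gaussianReal 0 1) i.1).map_eq
      change IsGaussian (Measure.map (Function.eval i.1) P)
      rw [this]
      infer_instance
    · have hp := measurePreserving_eval_infinitePi (fun _ : w => gaussianReal 0 1) i
      have : ∫ x, x ∂(gaussianReal 0 1) = ∫ ω, ω i ∂P := by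
        have h := integral_map (μ := P) (φ := Function.eval i) (measurable_pi_apply i).aemeasurable
          (f := fun x : ℝ => x) (by fun_prop)
        rw [hp.map_eq] at h
        exact h
      rw [← this]
      simp
  -- The isometry sends a Hilbert basis to independent standard normal variables.
  refine ⟨w → ℝ, inferInstance, P, inferInstance,
    (ho.orthogonalFamily.linearIsometry).comp b.repr.toLinearIsometry,
    limitSpace S₀ P hS₀.memLp, hS₀.limitSpace, fun v => ?_⟩
  set y := ((ho.orthogonalFamily.linearIsometry).comp b.repr.toLinearIsometry) v with hy
  have hsum : HasSum (fun i => (b.repr v i) • (hξ i).toLp) y :=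
    ho.orthogonalFamily.hasSum_linearIsometry (b.repr v)
  -- Finite partial sums of the basis expansion are classes of elements of `S₀`, so y is an L²-limit
  -- of such elements.
  have hcl : y ∈ closure {z : Lp ℝ 2 P | ∃ f ∈ S₀, (z : (w → ℝ) → ℝ) =ᵐ[P] f} := by
    refine mem_closure_of_tendsto hsum (Eventually.of_forall fun I => ?_)
    refine ⟨∑ i ∈ I, b.repr v i • fun ω => ω i, Submodule.sum_mem _ fun i _ =>
      Submodule.smul_mem _ _ (Submodule.subset_span ⟨i, rfl⟩), ?_⟩
    have h1 : (∑ i ∈ I, b.repr v i • (hξ i).toLp : Lp ℝ 2 P) =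
        (memLp_finsetSum' I fun i _ => (hξ i).const_smul (b.repr v i)).toLp := by
      refine Finset.induction_on (motive := fun I => (∑ i ∈ I, b.repr v i • (hξ i).toLp : Lp ℝ 2 P) =
        (memLp_finsetSum' I fun i _ => (hξ i).const_smul (b.repr v i)).toLp) I ?_ ?_
      · simp only [Finset.sum_empty]
        rfl
      · intro a s ha ih
        simp only [Finset.sum_insert ha, ih]
        rfl
    rw [h1]
    exact MemLp.coeFn_toLp _
  obtain ⟨z, hz, hzy⟩ := mem_closure_iff_seq_limit.1 hcl
  choose f hf hzf using hz
  refine ⟨Lp.memLp y, f, hf, ?_⟩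
  have h2 := (Lp.tendsto_Lp_iff_tendsto_eLpNorm' z y).1 hzy
  refine h2.congr fun k => eLpNorm_congr_ae ?_
  filter_upwards [hzf k] with ω hω
  simp [hω]

/-- Gaussian random measures with Lebesgue control exist. -/
theorem exists_isGaussianRandomMeasure (m n : ℕ) :
    ∃ (Ω : Type) (_ : MeasurableSpace Ω) (P : Measure Ω) (_ : IsProbabilityMeasure P)
      (W : Set (Vec ℝ m) → Ω → Vec ℝ n), IsGaussianRandomMeasure W P := by
  classical
  obtain ⟨Ω, _, P, _, J, S, hS, hJ⟩ := exists_isonormal (Lp (Vec ℝ n) 2 (volume : Measure (Vec ℝ m)))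
  have hind : ∀ A : {A : Set (Vec ℝ m) // MeasurableSet A ∧ volume A < ⊤}, ∀ i : Fin n, MemLp
      (A.1.indicator fun _ => (EuclideanSpace.single i 1 : Vec ℝ n)) 2 volume := fun A i =>
    memLp_indicator_const 2 A.2.1 _ (Or.inr A.2.2.ne)
  -- W(A)_i is the image of 1_A e_i under the isometry, so its covariances are the inner products of
  -- these indicators. The value 0 at the other sets is a default.
  let W : Set (Vec ℝ m) → Ω → Vec ℝ n := fun A ω => if hA : MeasurableSet A ∧ volume A < ⊤ then
    WithLp.toLp 2 fun i => J ((hind ⟨A, hA⟩ i).toLp _) ω else 0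
  have hWA : ∀ (A : {A : Set (Vec ℝ m) // MeasurableSet A ∧ volume A < ⊤}) ω i,
      W A ω i = J ((hind A i).toLp _) ω := fun A ω i => by
    simp only [W, dif_pos A.2]
  have hmem : ∀ (A : {A : Set (Vec ℝ m) // MeasurableSet A ∧ volume A < ⊤}) i,
      (fun ω => W A ω i) ∈ S := fun A i => by
    simp_rw [hWA]; exact hJ _
  have hG := hS.isGaussianProcess hmem
  refine ⟨Ω, inferInstance, P, inferInstance, W, hG, fun A hA hA' => ?_, ?_⟩
  · have h : HasGaussianLaw (W A) P := hG.hasGaussianLaw_eval ⟨A, hA, hA'⟩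
    ext i
    rw [← integral_euclideanSpace_apply h.integrable]
    exact (hS _ (hmem ⟨A, hA, hA'⟩ i)).2
  · intro A A' hA hA2 hA' hA2' i j
    simp_rw [hWA ⟨A, hA, hA2⟩, hWA ⟨A', hA', hA2'⟩]
    have h1 := inner_toLp_eq_integral (𝕜 := ℝ) (Lp.memLp (J ((hind ⟨A, hA, hA2⟩ i).toLp _)))
      (Lp.memLp (J ((hind ⟨A', hA', hA2'⟩ j).toLp _)))
    rw [← h1, Lp.toLp_coeFn, Lp.toLp_coeFn, J.inner_map_map, L2.inner_def]
    have h2 : ∫ x, inner ℝ ((hind ⟨A', hA', hA2'⟩ j).toLp _ x) ((hind ⟨A, hA, hA2⟩ i).toLp _ x) =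
        ∫ x, (A ∩ A').indicator (fun _ => if i = j then (1 : ℝ) else 0) x := by
      refine integral_congr_ae ?_
      filter_upwards [(hind ⟨A', hA', hA2'⟩ j).coeFn_toLp, (hind ⟨A, hA, hA2⟩ i).coeFn_toLp]
        with x hx hx'
      rw [hx, hx']
      by_cases h : x ∈ A <;> by_cases h' : x ∈ A' <;>
        simp [Set.indicator, h, h', EuclideanSpace.inner_single_left, eq_comm]
    rw [h2, integral_indicator (hA.inter hA'), setIntegral_const]
    split_ifs <;> simp [Measure.real]

end Existence

/-! ### Fourier transforms of functions as tempered distributions. -/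

section FourierPair

open SchwartzMap FourierTransform Real
open scoped ContDiff

/-! ### Linear changes of variables for Haar measure. -/

section LinearChange

variable {V : Type*} [NormedAddCommGroup V] [NormedSpace ℝ V] [FiniteDimensional ℝ V]
  [MeasurableSpace V] [BorelSpace V] (μ : Measure V) [μ.IsAddHaarMeasure]

theorem map_continuousLinearEquiv_addHaar (A : V ≃L[ℝ] V) :
    μ.map A = ENNReal.ofReal |(LinearMap.det (A : V →ₗ[ℝ] V))⁻¹| • μ :=
  Measure.map_linearMap_addHaar_eq_smul_addHaar μ (LinearEquiv.isUnit_det' A.toLinearEquiv).ne_zero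

theorem integral_comp_continuousLinearEquiv {G : Type*} [NormedAddCommGroup G] [NormedSpace ℝ G]
    (A : V ≃L[ℝ] V) (f : V → G) :
    ∫ x, f (A x) ∂μ = |(LinearMap.det (A : V →ₗ[ℝ] V))⁻¹| • ∫ x, f x ∂μ := by
  have h := A.toHomeomorph.measurableEmbedding.integral_map (μ := μ) f
  have h1 : ∫ x, f (A x) ∂μ = ∫ y, f y ∂(μ.map A) := h.symm
  rw [h1, map_continuousLinearEquiv_addHaar, integral_smul_measure,
    ENNReal.toReal_ofReal (abs_nonneg _)]

theorem lintegral_comp_continuousLinearEquiv (A : V ≃L[ℝ] V) (f : V → ENNReal) :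
    ∫⁻ x, f (A x) ∂μ = ENNReal.ofReal |(LinearMap.det (A : V →ₗ[ℝ] V))⁻¹| * ∫⁻ x, f x ∂μ := by
  have h := A.toHomeomorph.measurableEmbedding.lintegral_map (μ := μ) f
  have h1 : ∫⁻ x, f (A x) ∂μ = ∫⁻ y, f y ∂(μ.map A) := h.symm
  rw [h1, map_continuousLinearEquiv_addHaar, lintegral_smul_measure, smul_eq_mul]

theorem quasiMeasurePreserving_continuousLinearEquiv (A : V ≃L[ℝ] V) :
    Measure.QuasiMeasurePreserving A μ μ :=
  ⟨A.continuous.measurable, by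
    rw [map_continuousLinearEquiv_addHaar]; exact Measure.smul_absolutelyContinuous⟩

theorem integrable_comp_continuousLinearEquiv {G : Type*} [NormedAddCommGroup G] [NormedSpace ℝ G]
    (A : V ≃L[ℝ] V) {f : V → G} (hf : Integrable f μ) : Integrable (fun x => f (A x)) μ := by
  have h := A.toHomeomorph.measurableEmbedding.integrable_map_iff (μ := μ) (g := f)
  refine h.1 ?_
  have : μ.map A.toHomeomorph = μ.map A := rfl
  rw [this, map_continuousLinearEquiv_addHaar]
  exact hf.smul_measure ENNReal.ofReal_ne_top

end LinearChange

variable {V : Type*} [NormedAddCommGroup V] [InnerProductSpace ℝ V] [FiniteDimensional ℝ V]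
  [MeasurableSpace V] [BorelSpace V]

/-- `F` is the Fourier transform of `γ` in the sense of tempered distributions. -/
structure IsFourierPair (γ F : V → ℂ) : Prop where
  integrable_left : ∀ ψ : 𝓢(V, ℂ), Integrable fun x => γ x * ψ x
  integrable_right : ∀ ψ : 𝓢(V, ℂ), Integrable fun x => F x * ψ x
  integral_eq : ∀ ψ : 𝓢(V, ℂ), ∫ x, F x * ψ x = ∫ x, γ x * 𝓕 ψ x

namespace IsFourierPair

variable {γ γ' F F' : V → ℂ}

theorem add (h : IsFourierPair γ F) (h' : IsFourierPair γ' F') :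
    IsFourierPair (fun x => γ x + γ' x) fun x => F x + F' x where
  integrable_left ψ := ((h.1 ψ).add (h'.1 ψ)).congr (ae_of_all _ fun x => by simp [add_mul])
  integrable_right ψ := ((h.2 ψ).add (h'.2 ψ)).congr (ae_of_all _ fun x => by simp [add_mul])
  integral_eq ψ := by
    simp only [add_mul]
    rw [integral_add (h.2 ψ) (h'.2 ψ), integral_add (h.1 _) (h'.1 _), h.3, h'.3]

theorem const_mul (h : IsFourierPair γ F) (c : ℂ) :
    IsFourierPair (fun x => c * γ x) fun x => c * F x where
  integrable_left ψ := by simpa only [mul_assoc] using (h.1 ψ).const_mul c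
  integrable_right ψ := by simpa only [mul_assoc] using (h.2 ψ).const_mul c
  integral_eq ψ := by
    simp only [mul_assoc]
    rw [integral_const_mul, integral_const_mul, h.3]

theorem sub (h : IsFourierPair γ F) (h' : IsFourierPair γ' F') :
    IsFourierPair (fun x => γ x - γ' x) fun x => F x - F' x := by
  simpa [sub_eq_add_neg] using h.add (h'.const_mul (-1))

theorem zero : IsFourierPair (fun _ : V => (0 : ℂ)) fun _ => 0 :=
  ⟨by simp, by simp, by simp⟩

theorem sum {ι : Type*} (s : Finset ι) {γ F : ι → V → ℂ} (h : ∀ i ∈ s, IsFourierPair (γ i) (F i)) :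
    IsFourierPair (fun x => ∑ i ∈ s, γ i x) fun x => ∑ i ∈ s, F i x := by
  classical
  induction s using Finset.induction_on with
  | empty => simpa using zero
  | insert a s ha ih =>
    simp only [Finset.sum_insert ha]
    exact (h a (Finset.mem_insert_self a s)).add (ih fun i hi => h i (Finset.mem_insert_of_mem hi))

theorem congr_left (h : IsFourierPair γ F) (hγ : γ =ᵐ[volume] γ') : IsFourierPair γ' F where
  integrable_left ψ := (h.1 ψ).congr (hγ.mono fun x hx => by simp only [hx])
  integrable_right := h.2
  integral_eq ψ := by
    rw [h.3]
    exact integral_congr_ae (hγ.mono fun x hx => by simp only [hx])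

/-- On a compact set F agrees with its product with a smooth bump that equals 1 there. -/
theorem locallyIntegrable (h : IsFourierPair γ F) : LocallyIntegrable F := by
  rw [locallyIntegrable_iff]
  intro K hK
  obtain ⟨R, hR, hKR⟩ := hK.isBounded.subset_closedBall_lt 0 (0 : V)
  let b : ContDiffBump (0 : V) := ⟨R, R + 1, hR, by linarith⟩
  have hc : HasCompactSupport fun x => (b x : ℂ) :=
    b.hasCompactSupport.comp_left (g := fun r : ℝ => (r : ℂ)) Complex.ofReal_zero
  have hd : ContDiff ℝ ∞ fun x => (b x : ℂ) := Complex.ofRealCLM.contDiff.comp b.contDiff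
  have h1 := (h.2 (hc.toSchwartzMap hd)).integrableOn (s := K)
  refine h1.congr_fun (fun x hx => ?_) hK.measurableSet
  have : b x = 1 := b.one_of_mem_closedBall (hKR hx)
  simp [this]

/-- Uniqueness of the transform: the difference pairs to zero with every smooth compactly supported
function. Every identity for F below is proved by exhibiting both sides as transforms of one
function. -/
theorem ae_eq (h : IsFourierPair γ F) (h' : IsFourierPair γ F') : F =ᵐ[volume] F' := by
  have h0 := h.sub h'
  have := ae_eq_zero_of_integral_contDiff_smul_eq_zero h0.locallyIntegrable fun g hg hgs => ?_
  · filter_upwards [this] with x hx using sub_eq_zero.1 hx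
  · have hc : HasCompactSupport fun x => (g x : ℂ) :=
      hgs.comp_left (g := fun r : ℝ => (r : ℂ)) Complex.ofReal_zero
    have hd : ContDiff ℝ ∞ fun x => (g x : ℂ) := Complex.ofRealCLM.contDiff.comp hg
    have h1 := h0.3 (hc.toSchwartzMap hd)
    simp only [sub_self, zero_mul, integral_zero, HasCompactSupport.toSchwartzMap_toFun] at h1
    rw [← h1]
    congr 1 with x
    rw [Complex.real_smul, mul_comm]

theorem of_integrable (hγ : Integrable γ) : IsFourierPair γ (𝓕 γ) where
  integrable_left ψ := by
    refine hγ.mul_bdd (c := ‖ψ.toBoundedContinuousFunction‖) ψ.continuous.aestronglyMeasurable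
      (ae_of_all _ fun x => ψ.toBoundedContinuousFunction.norm_coe_le_norm x)
  integrable_right ψ := by
    have hc : Continuous (𝓕 γ) :=
      VectorFourier.fourierIntegral_continuous continuous_fourierChar continuous_inner hγ
    refine ψ.integrable.bdd_mul (c := ∫ v, ‖γ v‖) hc.aestronglyMeasurable (ae_of_all _ fun x => ?_)
    exact VectorFourier.norm_fourierIntegral_le_integral_norm _ _ _ _ _
  integral_eq ψ := by
    simpa using! VectorFourier.integral_fourierIntegral_smul_eq_flip (L := innerₗ V)
      continuous_fourierChar continuous_inner hγ ψ.integrable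

theorem of_memLp (hγ : MemLp γ 2) : IsFourierPair γ (𝓕 hγ.toLp : Lp ℂ 2 (volume : Measure V)) where
  integrable_left ψ := hγ.integrable_mul (ψ.memLp 2)
  integrable_right ψ := (Lp.memLp _).integrable_mul (ψ.memLp 2)
  integral_eq ψ := by
    have h := congrArg (fun T => T ψ) (Lp.fourier_toTemperedDistribution_eq hγ.toLp)
    simp only [TemperedDistribution.fourier_apply, Lp.toTemperedDistribution_apply, smul_eq_mul] at h
    simp_rw [mul_comm _ (ψ _)]
    rw [← h]
    refine integral_congr_ae ?_
    filter_upwards [hγ.coeFn_toLp] with x hx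
    rw [hx, mul_comm]

/-- Plancherel's theorem. -/
theorem memLp (h : IsFourierPair γ F) (hγ : MemLp γ 2) : MemLp F 2 :=
  (memLp_congr_ae (h.ae_eq (of_memLp hγ))).2 (Lp.memLp _)

/-- Plancherel's theorem, polarized. -/
theorem integral_mul_conj (h : IsFourierPair γ F) (h' : IsFourierPair γ' F') (hγ : MemLp γ 2)
    (hγ' : MemLp γ' 2) :
    ∫ x, F x * starRingEnd ℂ (F' x) = ∫ x, γ x * starRingEnd ℂ (γ' x) := by
  rw [← inner_toLp_eq_integral hγ hγ', ← Lp.inner_fourier_eq, L2.inner_def]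
  refine integral_congr_ae ?_
  filter_upwards [h.ae_eq (of_memLp hγ), h'.ae_eq (of_memLp hγ')] with x h1 h2
  rw [RCLike.inner_apply, h1, h2]

/-- The shift is moved onto the test function, whose transform then acquires the character. -/
theorem translate (h : IsFourierPair γ F) (t : V) :
    IsFourierPair (fun x => Complex.exp (2 * π * inner ℝ x t * Complex.I) * γ x)
      fun u => F (u - t) where
  integrable_left ψ := by
    simp only [mul_assoc]
    refine Integrable.bdd_mul (c := 1) (h.1 ψ) ?_ (ae_of_all _ fun x => ?_)
    · exact (by fun_prop : Continuous fun x : V =>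
        Complex.exp (2 * (π * (inner ℝ x t * Complex.I)))).aestronglyMeasurable
    · have : 2 * (π * ((inner ℝ x t : ℝ) * Complex.I)) = (2 * π * inner ℝ x t : ℝ) * Complex.I := by
        push_cast; ring
      rw [this, Complex.norm_exp_ofReal_mul_I]
  integrable_right ψ := by
    have := (h.2 (ψ.compSubConstCLM ℂ (-t))).comp_sub_right t
    simpa using this
  integral_eq ψ := by
    have h1 : ∫ u, F (u - t) * ψ u = ∫ u, F u * ψ.compSubConstCLM ℂ (-t) u := by
      have := integral_sub_right_eq_self (μ := volume) (fun u => F u * ψ (u + t)) t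
      simpa using this
    rw [h1, h.3]
    congr 1 with x
    have h2 : 𝓕 (ψ.compSubConstCLM ℂ (-t)) x =
        Complex.exp (2 * π * inner ℝ x t * Complex.I) * 𝓕 ψ x := by
      rw [SchwartzMap.fourier_coe, SchwartzMap.fourier_coe, fourier_eq', fourier_eq',
        ← integral_const_mul, ← integral_sub_right_eq_self _ t]
      congr 1 with v
      simp only [compSubConstCLM_apply, sub_neg_eq_add, sub_add_cancel, smul_eq_mul]
      rw [← mul_assoc, ← Complex.exp_add, inner_sub_left, real_inner_comm x t]
      congr 2
      push_cast
      ring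
    rw [h2]
    ring

/-- Here B is the adjoint of A. The dilation is moved onto the test function, and changes of
variables by A and by B produce the Jacobian factor. -/
theorem comp_linear (h : IsFourierPair γ F) (A B : V ≃L[ℝ] V)
    (hAB : ∀ u x, inner ℝ (A u) x = inner ℝ u (B x))
    (hdet : |LinearMap.det (A : V →ₗ[ℝ] V)| = |LinearMap.det (B : V →ₗ[ℝ] V)|) :
    IsFourierPair (fun x => γ (B.symm x))
      fun u => ((|LinearMap.det (A : V →ₗ[ℝ] V)| : ℝ) : ℂ) * F (A u) where
  integrable_left ψ := by
    have := integrable_comp_continuousLinearEquiv volume B.symm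
      (h.1 (compCLMOfContinuousLinearEquiv ℂ B ψ))
    simpa using this
  integrable_right ψ := by
    have := integrable_comp_continuousLinearEquiv volume A
      (h.2 (compCLMOfContinuousLinearEquiv ℂ A.symm ψ))
    simpa [mul_assoc] using this.const_mul ((|LinearMap.det (A : V →ₗ[ℝ] V)| : ℝ) : ℂ)
  integral_eq ψ := by
    have hA0 : |LinearMap.det (A : V →ₗ[ℝ] V)| ≠ 0 :=
      abs_ne_zero.2 (LinearEquiv.isUnit_det' A.toLinearEquiv).ne_zero
    have h1 : ∫ u, ((|LinearMap.det (A : V →ₗ[ℝ] V)| : ℝ) : ℂ) * F (A u) * ψ u =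
        ∫ u, F u * compCLMOfContinuousLinearEquiv ℂ A.symm ψ u := by
      have := integral_comp_continuousLinearEquiv volume A
        fun u => F u * compCLMOfContinuousLinearEquiv ℂ A.symm ψ u
      simp only [compCLMOfContinuousLinearEquiv_apply, Function.comp_apply,
        ContinuousLinearEquiv.symm_apply_apply] at this
      simp_rw [mul_assoc]
      rw [integral_const_mul, this, abs_inv, Complex.real_smul, ← mul_assoc, Complex.ofReal_inv,
        mul_inv_cancel₀ (by exact_mod_cast hA0), one_mul]
      rfl
    have h2 : ∀ x, 𝓕 (compCLMOfContinuousLinearEquiv ℂ A.symm ψ) x =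
        ((|LinearMap.det (A : V →ₗ[ℝ] V)| : ℝ) : ℂ) * 𝓕 ψ (B x) := fun x => by
      rw [SchwartzMap.fourier_coe, SchwartzMap.fourier_coe, fourier_eq', fourier_eq']
      have := integral_comp_continuousLinearEquiv volume A
        fun v => Complex.exp (↑(-2 * π * inner ℝ v x) * Complex.I) • ψ (A.symm v)
      simp only [ContinuousLinearEquiv.symm_apply_apply, hAB] at this
      rw [this, abs_inv, Complex.real_smul, ← mul_assoc, Complex.ofReal_inv,
        mul_inv_cancel₀ (by exact_mod_cast hA0), one_mul]
      rfl
    have h3 := integral_comp_continuousLinearEquiv volume B fun x => γ (B.symm x) * 𝓕 ψ x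
    simp only [ContinuousLinearEquiv.symm_apply_apply] at h3
    rw [h1, h.3]
    simp_rw [h2, mul_left_comm (γ _)]
    rw [integral_const_mul, h3, abs_inv, ← hdet, Complex.real_smul, ← mul_assoc, Complex.ofReal_inv,
      mul_inv_cancel₀ (by exact_mod_cast hA0), one_mul]

theorem conj (h : IsFourierPair γ F) :
    IsFourierPair (fun x => starRingEnd ℂ (γ (-x))) fun u => starRingEnd ℂ (F u) where
  integrable_left ψ := by
    have h1 := (h.1 ((compCLMOfContinuousLinearEquiv ℝ (ContinuousLinearEquiv.neg ℝ)
      (ψ.postcompCLM (𝕜 := ℝ) (Complex.conjCLE : ℂ →L[ℝ] ℂ))))).comp_neg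
    have h2 := (Complex.conjCLE : ℂ →L[ℝ] ℂ).integrable_comp h1
    simpa using h2
  integrable_right ψ := by
    have h1 := h.2 (ψ.postcompCLM (𝕜 := ℝ) (Complex.conjCLE : ℂ →L[ℝ] ℂ))
    have h2 := (Complex.conjCLE : ℂ →L[ℝ] ℂ).integrable_comp h1
    simpa using h2
  integral_eq ψ := by
    have h1 := congrArg (starRingEnd ℂ) (h.3 (ψ.postcompCLM (𝕜 := ℝ) (Complex.conjCLE : ℂ →L[ℝ] ℂ)))
    rw [← integral_conj, ← integral_conj] at h1
    simp only [map_mul, postcompCLM_apply, ContinuousLinearEquiv.coe_coe, Complex.conjCLE_apply,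
      Complex.conj_conj] at h1
    rw [h1, ← integral_neg_eq_self]
    congr 1 with x
    congr 1
    rw [SchwartzMap.fourier_coe, SchwartzMap.fourier_coe, fourier_eq', fourier_eq', ← integral_conj]
    congr 1 with v
    simp only [smul_eq_mul, map_mul, postcompCLM_apply, ContinuousLinearEquiv.coe_coe,
      Complex.conjCLE_apply, Complex.conj_conj, ← Complex.exp_conj, Complex.conj_ofReal,
      Complex.conj_I, inner_neg_right]
    congr 2
    push_cast
    ring

end IsFourierPair

end FourierPair

/-! ### Powers c^A of a matrix. -/

section MatrixPower

variable {k : ℕ} {A W : Mat ℝ k} {d : Fin k → ℝ}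

theorem cpow_eq_of_diagonalization (hW : IsUnit W.det) (hA : A = W * Matrix.diagonal d * W⁻¹)
    {c : ℝ} (hc : 0 < c) : cpow c A = W * Matrix.diagonal (fun i => c ^ d i) * W⁻¹ := by
  have h1 : Real.log c • A = W * Matrix.diagonal (Real.log c • d) * W⁻¹ := by
    rw [hA, Matrix.diagonal_smul, Matrix.mul_smul, Matrix.smul_mul]
  rw [cpow, h1, Matrix.exp_conj _ _ ((Matrix.isUnit_iff_isUnit_det _).2 hW), Matrix.exp_diagonal]
  congr 3
  ext i
  rw [Pi.coe_exp, Real.rpow_def_of_pos hc, Real.exp_eq_exp_ℝ]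
  rfl

theorem cpow_mul {a b : ℝ} (ha : 0 < a) (hb : 0 < b) (A : Mat ℝ k) :
    cpow (a * b) A = cpow a A * cpow b A := by
  rw [cpow, cpow, cpow, Real.log_mul ha.ne' hb.ne', add_smul]
  exact Matrix.exp_add_of_commute _ _ ((Commute.refl A).smul_left _ |>.smul_right _)

theorem cpow_one (A : Mat ℝ k) : cpow 1 A = 1 := by
  simp [cpow, NormedSpace.exp_zero]

theorem cpow_mul_cpow_inv {c : ℝ} (hc : 0 < c) (A : Mat ℝ k) : cpow c A * cpow c⁻¹ A = 1 := by
  rw [← cpow_mul hc (inv_pos.2 hc), mul_inv_cancel₀ hc.ne', cpow_one]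

theorem cpow_inv_mul_cpow {c : ℝ} (hc : 0 < c) (A : Mat ℝ k) : cpow c⁻¹ A * cpow c A = 1 := by
  rw [← cpow_mul (inv_pos.2 hc) hc, inv_mul_cancel₀ hc.ne', cpow_one]

theorem cpow_transpose (c : ℝ) (A : Mat ℝ k) : cpow c Aᵀ = (cpow c A)ᵀ := by
  rw [cpow, cpow, ← Matrix.exp_transpose, Matrix.transpose_smul]

theorem cpow_neg (c : ℝ) (A : Mat ℝ k) : cpow c (-A) = cpow c⁻¹ A := by
  rw [cpow, cpow, Real.log_inv, smul_neg, neg_smul]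

theorem cpow_smul_one {c : ℝ} (hc : 0 < c) (r : ℝ) :
    cpow c (r • (1 : Mat ℝ k)) = (c ^ r) • (1 : Mat ℝ k) := by
  have h : r • (1 : Mat ℝ k) = 1 * Matrix.diagonal (fun _ => r) * 1⁻¹ := by
    simp [Matrix.smul_one_eq_diagonal]
  rw [cpow_eq_of_diagonalization (by simp) h hc]
  simp [Matrix.smul_one_eq_diagonal]

theorem cpow_add_smul_one {c : ℝ} (hc : 0 < c) (A : Mat ℝ k) (r : ℝ) :
    cpow c (A + r • (1 : Mat ℝ k)) = (c ^ r) • cpow c A := by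
  have h : cpow c (A + r • (1 : Mat ℝ k)) = cpow c A * cpow c (r • (1 : Mat ℝ k)) := by
    rw [cpow, cpow, cpow, smul_add]
    refine Matrix.exp_add_of_commute _ _ (Commute.smul_left (Commute.smul_right ?_ _) _)
    exact (Commute.one_right A).smul_right _
  rw [h, cpow_smul_one hc, Matrix.mul_smul, mul_one]

theorem det_cpow (hW : IsUnit W.det) (hA : A = W * Matrix.diagonal d * W⁻¹)
    {c : ℝ} (hc : 0 < c) : (cpow c A).det = c ^ A.trace := by
  rw [cpow_eq_of_diagonalization hW hA hc,
    Matrix.det_conj ((Matrix.isUnit_iff_isUnit_det _).2 hW), Matrix.det_diagonal,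
    ← Real.rpow_sum_of_pos hc, hA, Matrix.trace_mul_cycle, Matrix.nonsing_inv_mul _ hW, one_mul,
    Matrix.trace_diagonal]

theorem RealDiagonalizable.transpose (h : RealDiagonalizable A) : RealDiagonalizable Aᵀ := by
  obtain ⟨W, d, hW, rfl⟩ := h
  refine ⟨Wᵀ⁻¹, d, ?_, ?_⟩
  · rw [Matrix.det_nonsing_inv, Matrix.det_transpose, isUnit_ringInverse]
    exact hW
  · rw [Matrix.nonsing_inv_nonsing_inv _ (by rwa [Matrix.det_transpose]), Matrix.transpose_mul,
      Matrix.transpose_mul, Matrix.diagonal_transpose, Matrix.transpose_nonsing_inv, mul_assoc]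

theorem mem_spectrum_of_diagonalization (hW : IsUnit W.det)
    (hA : A = W * Matrix.diagonal d * W⁻¹) (i : Fin k) : d i ∈ spectrum ℝ A := by
  obtain ⟨u, rfl⟩ := (Matrix.isUnit_iff_isUnit_det _).2 hW
  rw [hA, ← Matrix.coe_units_inv, spectrum.units_conjugate, spectrum_diagonal]
  exact ⟨i, rfl⟩

theorem spectrum_transpose (A : Mat ℝ k) : spectrum ℝ Aᵀ = spectrum ℝ A := by
  ext r
  rw [spectrum.mem_iff, spectrum.mem_iff, Matrix.isUnit_iff_isUnit_det,
    Matrix.isUnit_iff_isUnit_det, ← Matrix.det_transpose]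
  congr! 3
  simp [Algebra.algebraMap_eq_smul_one]

end MatrixPower

/-! ### Matrices acting on Euclidean space. -/

section Action

variable {k : ℕ}

theorem act_mul {𝕜 : Type*} [RCLike 𝕜] (A B : Mat 𝕜 k) (x : Vec 𝕜 k) :
    act (A * B) x = act A (act B x) := by
  simp [act, Matrix.mulVec_mulVec]

theorem act_one {𝕜 : Type*} [RCLike 𝕜] (x : Vec 𝕜 k) : act (1 : Mat 𝕜 k) x = x := by
  simp [act]

theorem continuous_act_uncurry : Continuous fun p : Mat ℝ k × Vec ℝ k => act p.1 p.2 := by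
  refine (PiLp.continuous_toLp 2 _).comp ?_
  exact continuous_fst.matrix_mulVec ((PiLp.continuous_ofLp 2 _).comp continuous_snd)

theorem continuous_act (A : Mat ℝ k) : Continuous (act A) :=
  continuous_act_uncurry.comp (Continuous.prodMk_right A)

theorem inner_act (A : Mat ℝ k) (u x : Vec ℝ k) :
    inner ℝ (act A u) x = inner ℝ u (act Aᵀ x) := by
  simp only [act, EuclideanSpace.inner_eq_star_dotProduct, star_trivial]
  rw [Matrix.mulVec_transpose, ← Matrix.dotProduct_mulVec]

/-- The action of an invertible matrix as a continuous linear equivalence. -/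
def actEquiv (A B : Mat ℝ k) (hAB : A * B = 1) (hBA : B * A = 1) : Vec ℝ k ≃L[ℝ] Vec ℝ k where
  toFun := act A
  invFun := act B
  left_inv x := by rw [← act_mul, hBA, act_one]
  right_inv x := by rw [← act_mul, hAB, act_one]
  map_add' x y := by simp [act, Matrix.mulVec_add]
  map_smul' c x := by simp [act, Matrix.mulVec_smul]
  continuous_toFun := continuous_act A
  continuous_invFun := continuous_act B

theorem det_actEquiv (A B : Mat ℝ k) (hAB : A * B = 1) (hBA : B * A = 1) :
    LinearMap.det (actEquiv A B hAB hBA : Vec ℝ k →ₗ[ℝ] Vec ℝ k) = A.det := by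
  have : (actEquiv A B hAB hBA : Vec ℝ k →ₗ[ℝ] Vec ℝ k) =
      Matrix.toLin (EuclideanSpace.basisFun (Fin k) ℝ).toBasis
        (EuclideanSpace.basisFun (Fin k) ℝ).toBasis A := by
    refine (EuclideanSpace.basisFun (Fin k) ℝ).toBasis.ext fun i => ?_
    rw [Matrix.toLin_self]
    ext j
    have h1 : act A (EuclideanSpace.single i 1) j = A j i := by simp [act]
    simp only [OrthonormalBasis.coe_toBasis, EuclideanSpace.basisFun_apply]
    refine h1.trans ?_
    simp [Finset.sum_apply, Pi.single_apply]
  rw [this, LinearMap.det_toLin]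

/-- The action of `c ^ A`. -/
def cpowEquiv {c : ℝ} (hc : 0 < c) (A : Mat ℝ k) : Vec ℝ k ≃L[ℝ] Vec ℝ k :=
  actEquiv (cpow c A) (cpow c⁻¹ A) (cpow_mul_cpow_inv hc A) (cpow_inv_mul_cpow hc A)

theorem cpowEquiv_apply {c : ℝ} (hc : 0 < c) (A : Mat ℝ k) (x : Vec ℝ k) :
    cpowEquiv hc A x = act (cpow c A) x := rfl

theorem cpowEquiv_symm_apply {c : ℝ} (hc : 0 < c) (A : Mat ℝ k) (x : Vec ℝ k) :
    (cpowEquiv hc A).symm x = act (cpow c⁻¹ A) x := rfl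

theorem det_cpowEquiv {A : Mat ℝ k} (hA : RealDiagonalizable A) {c : ℝ} (hc : 0 < c) :
    LinearMap.det (cpowEquiv hc A : Vec ℝ k →ₗ[ℝ] Vec ℝ k) = c ^ A.trace := by
  obtain ⟨W, d, hW, h⟩ := hA
  rw [cpowEquiv, det_actEquiv, det_cpow hW h hc]

end Action

/-! ### A gauge adapted to the action of c^A. -/

section Gauge

variable {k : ℕ} {A : Mat ℝ k}

/-- A continuous gauge that is homogeneous of degree one for the action of `c ^ A`. -/
theorem exists_homogeneous_gauge (hA : RealDiagonalizable A) (hpos : ∀ e ∈ spectrum ℝ A, 0 < e) :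
    ∃ τ : Vec ℝ k → ℝ, Continuous τ ∧ (∀ x, x ≠ 0 → 0 < τ x) ∧ τ 0 = 0 ∧
      (∀ c : ℝ, 0 < c → ∀ x, τ (act (cpow c A) x) = c * τ x) ∧
      IsCompact {x | 1 ≤ τ x ∧ τ x ≤ 2} := by
  obtain ⟨W, d, hW, hA⟩ := hA
  have hd : ∀ i, 0 < d i := fun i => hpos _ (mem_spectrum_of_diagonalization hW hA i)
  have hWi : W⁻¹ * W = 1 := Matrix.nonsing_inv_mul _ hW
  have hiW : W * W⁻¹ = 1 := Matrix.mul_nonsing_inv _ hW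
  -- In eigencoordinates c^A multiplies coordinate i by c^{d i}; the exponent 1/d i makes each term
  -- homogeneous of degree one.
  let τ : Vec ℝ k → ℝ := fun x => ∑ i, |act W⁻¹ x i| ^ (d i)⁻¹
  have hcont : Continuous τ := by
    refine continuous_finsetSum _ fun i _ => ?_
    refine Continuous.rpow_const ?_ fun x => Or.inr (inv_nonneg.2 (hd i).le)
    exact (((EuclideanSpace.proj i : Vec ℝ k →L[ℝ] ℝ).continuous).comp (continuous_act _)).abs
  refine ⟨τ, hcont, fun x hx => ?_, ?_, fun c hc x => ?_, ?_⟩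
  · by_contra h
    have h0 : τ x = 0 := le_antisymm (not_lt.1 h) (Finset.sum_nonneg fun i _ => by positivity)
    rw [Finset.sum_eq_zero_iff_of_nonneg fun i _ => by positivity] at h0
    refine hx ?_
    have h1 : act W⁻¹ x = 0 := by
      ext i
      have := h0 i (Finset.mem_univ i)
      rw [Real.rpow_eq_zero (abs_nonneg _) (inv_pos.2 (hd i)).ne', abs_eq_zero] at this
      exact this
    rw [← act_one x, ← hiW, act_mul, h1]
    simp [act]
  · refine Finset.sum_eq_zero fun i _ => ?_
    simp [act, (hd i).ne']
  · have h1 : act W⁻¹ (act (cpow c A) x) = act (Matrix.diagonal fun i => c ^ d i) (act W⁻¹ x) := by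
      rw [← act_mul, ← act_mul, cpow_eq_of_diagonalization hW hA hc, ← mul_assoc, ← mul_assoc, hWi,
        one_mul]
    simp only [τ, h1, Finset.mul_sum]
    refine Finset.sum_congr rfl fun i _ => ?_
    have h2 : act (Matrix.diagonal fun i => c ^ d i) (act W⁻¹ x) i = c ^ d i * act W⁻¹ x i :=
      Matrix.mulVec_diagonal _ _ i
    rw [h2, abs_mul, abs_of_pos (Real.rpow_pos_of_pos hc _),
      Real.mul_rpow (Real.rpow_nonneg hc.le _) (abs_nonneg _), ← Real.rpow_mul hc.le,
      mul_inv_cancel₀ (hd i).ne', Real.rpow_one]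
  · refine Metric.isCompact_of_isClosed_isBounded
      ((isClosed_Ici.preimage hcont).inter (isClosed_Iic.preimage hcont)) ?_
    -- Each term of the gauge is at most 2, so the i-th eigencoordinate is at most 2^{d i}.
    let R : ℝ := ∑ i, (2 : ℝ) ^ d i
    have hsub : {x | 1 ≤ τ x ∧ τ x ≤ 2} ⊆ act W '' Metric.closedBall 0 R := by
      intro x hx
      refine ⟨act W⁻¹ x, ?_, by rw [← act_mul, hiW, act_one]⟩
      rw [mem_closedBall_zero_iff]
      refine (euclideanSpace_norm_le_sum _).trans (Finset.sum_le_sum fun i _ => ?_)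
      have h1 : |act W⁻¹ x i| ^ (d i)⁻¹ ≤ 2 :=
        (Finset.single_le_sum (f := fun i => |act W⁻¹ x i| ^ (d i)⁻¹)
          (fun i _ => by positivity) (Finset.mem_univ i)).trans hx.2
      have h2 := Real.rpow_le_rpow (by positivity) h1 (hd i).le
      rwa [← Real.rpow_mul (abs_nonneg _), inv_mul_cancel₀ (hd i).ne', Real.rpow_one] at h2
    exact (((isCompact_closedBall _ _).image (continuous_act W)).isBounded).subset hsub

end Gauge

/-! ### Finiteness of integrals by summation over shells. -/

section Shells

variable {V : Type*} [NormedAddCommGroup V] [NormedSpace ℝ V] [FiniteDimensional ℝ V]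
  [MeasurableSpace V] [BorelSpace V] (μ : Measure V) [μ.IsAddHaarMeasure]

theorem setLIntegral_image_continuousLinearEquiv (A : V ≃L[ℝ] V) {D : Set V} (hD : MeasurableSet D)
    (f : V → ENNReal) :
    ∫⁻ x in A '' D, f x ∂μ =
      ENNReal.ofReal |LinearMap.det (A : V →ₗ[ℝ] V)| * ∫⁻ x in D, f (A x) ∂μ := by
  have hA0 : |LinearMap.det (A : V →ₗ[ℝ] V)| ≠ 0 :=
    abs_ne_zero.2 (LinearEquiv.isUnit_det' A.toLinearEquiv).ne_zero
  have hAD : MeasurableSet (A '' D) := A.toHomeomorph.measurableEmbedding.measurableSet_image.2 hD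
  have h := lintegral_comp_continuousLinearEquiv μ A ((A '' D).indicator f)
  have h1 : (fun x => (A '' D).indicator f (A x)) = D.indicator fun x => f (A x) := by
    ext x
    by_cases hx : x ∈ D
    · rw [Set.indicator_of_mem (Set.mem_image_of_mem A hx), Set.indicator_of_mem hx]
    · rw [Set.indicator_of_notMem hx, Set.indicator_of_notMem]
      rintro ⟨y, hy, hyx⟩
      exact hx (A.injective hyx ▸ hy)
  rw [h1, lintegral_indicator hD, lintegral_indicator hAD] at h
  rw [h, ← mul_assoc, ← ENNReal.ofReal_mul (abs_nonneg _), abs_inv, mul_inv_cancel₀ hA0,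
    ENNReal.ofReal_one, one_mul]

/-- The images of the basic shell D cover U, and after a change of variables the l-th one
contributes at most `b l` times the integral over D. -/
theorem setLIntegral_lt_top_of_shells {D U : Set V} (hD : MeasurableSet D) (A : ℕ → V ≃L[ℝ] V)
    {f : V → ENNReal} {b : ℕ → ℝ} (hb : Summable b) (hU : U ⊆ ⋃ l, A l '' D)
    (hf : ∫⁻ x in D, f x ∂μ < ⊤)
    (h : ∀ l, ∀ x ∈ D, ENNReal.ofReal |LinearMap.det (A l : V →ₗ[ℝ] V)| * f (A l x) ≤
      ENNReal.ofReal (b l) * f x) :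
    ∫⁻ x in U, f x ∂μ < ⊤ := by
  calc ∫⁻ x in U, f x ∂μ ≤ ∫⁻ x in ⋃ l, A l '' D, f x ∂μ := lintegral_mono_set hU
    _ ≤ ∑' l, ∫⁻ x in A l '' D, f x ∂μ := lintegral_iUnion_le _ _
    _ ≤ ∑' l, ENNReal.ofReal (b l) * ∫⁻ x in D, f x ∂μ := by
        refine ENNReal.tsum_le_tsum fun l => ?_
        rw [setLIntegral_image_continuousLinearEquiv μ _ hD,
          ← lintegral_const_mul' _ _ ENNReal.ofReal_ne_top,
          ← lintegral_const_mul' _ _ ENNReal.ofReal_ne_top]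
        exact setLIntegral_mono' hD (h l)
    _ < ⊤ := by
        rw [ENNReal.tsum_mul_right]
        exact ENNReal.mul_lt_top hb.tsum_ofReal_lt_top hf

end Shells

/-! ### A submultiplicative size of matrices. -/

section EntrySum

variable {n : ℕ}

/-- The sum of the absolute values of the entries of a matrix. -/
def entrySum {𝕜 : Type*} [RCLike 𝕜] (G : Mat 𝕜 n) : ℝ := ∑ i, ∑ j, ‖G i j‖

theorem entrySum_nonneg {𝕜 : Type*} [RCLike 𝕜] (G : Mat 𝕜 n) : 0 ≤ entrySum G :=
  Finset.sum_nonneg fun _ _ => Finset.sum_nonneg fun _ _ => norm_nonneg _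

theorem norm_le_entrySum {𝕜 : Type*} [RCLike 𝕜] (G : Mat 𝕜 n) (i j : Fin n) :
    ‖G i j‖ ≤ entrySum G :=
  (Finset.single_le_sum (f := fun j => ‖G i j‖) (fun _ _ => norm_nonneg _) (Finset.mem_univ j)).trans
    (Finset.single_le_sum (f := fun i => ∑ j, ‖G i j‖)
      (fun _ _ => Finset.sum_nonneg fun _ _ => norm_nonneg _) (Finset.mem_univ i))

theorem entrySum_mul_le {𝕜 : Type*} [RCLike 𝕜] (M G : Mat 𝕜 n) :
    entrySum (M * G) ≤ entrySum M * entrySum G := by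
  calc entrySum (M * G) ≤ ∑ i, ∑ j, ∑ k, ‖M i k‖ * ‖G k j‖ := by
        refine Finset.sum_le_sum fun i _ => Finset.sum_le_sum fun j _ => ?_
        rw [Matrix.mul_apply]
        exact (norm_sum_le _ _).trans (Finset.sum_le_sum fun k _ => norm_mul_le _ _)
    _ = ∑ i, ∑ k, ‖M i k‖ * ∑ j, ‖G k j‖ := by
        refine Finset.sum_congr rfl fun i _ => ?_
        rw [Finset.sum_comm]
        exact Finset.sum_congr rfl fun k _ => (Finset.mul_sum _ _ _).symm
    _ ≤ ∑ i, ∑ k, ‖M i k‖ * entrySum G := by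
        refine Finset.sum_le_sum fun i _ => Finset.sum_le_sum fun k _ => ?_
        refine mul_le_mul_of_nonneg_left ?_ (norm_nonneg _)
        exact Finset.single_le_sum (f := fun k => ∑ j, ‖G k j‖)
          (fun _ _ => Finset.sum_nonneg fun _ _ => norm_nonneg _) (Finset.mem_univ k)
    _ = entrySum M * entrySum G := by
        simp_rw [← Finset.sum_mul]
        rfl

theorem entrySum_smul (c : ℝ) (M : Mat ℝ n) : entrySum (c • M) = |c| * entrySum M := by
  simp [entrySum, Finset.mul_sum]

theorem entrySum_map_ofReal (M : Mat ℝ n) : entrySum (M.map (algebraMap ℝ ℂ)) = entrySum M := by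
  simp [entrySum]

theorem entrySum_diagonal (d : Fin n → ℝ) : entrySum (Matrix.diagonal d) = ∑ i, |d i| := by
  refine Finset.sum_congr rfl fun i _ => ?_
  rw [Finset.sum_eq_single i] <;> simp +contextual [eq_comm]

theorem exists_entrySum_cpow_le {H W : Mat ℝ n} {d : Fin n → ℝ} (hW : IsUnit W.det)
    (hH : H = W * Matrix.diagonal d * W⁻¹) (a : ℝ) :
    ∃ K : ℝ, 0 ≤ K ∧ ∀ c : ℝ, 0 < c → entrySum (cpow c (-(H + a • (1 : Mat ℝ n)))) ≤
      c⁻¹ ^ a * (K * ∑ i, c⁻¹ ^ d i) := by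
  refine ⟨entrySum W * entrySum W⁻¹, mul_nonneg (entrySum_nonneg _) (entrySum_nonneg _),
    fun c hc => ?_⟩
  have hc' : 0 < c⁻¹ := inv_pos.2 hc
  rw [cpow_neg, cpow_add_smul_one hc', entrySum_smul, abs_of_pos (Real.rpow_pos_of_pos hc' _)]
  refine mul_le_mul_of_nonneg_left ?_ (Real.rpow_nonneg hc'.le _)
  rw [cpow_eq_of_diagonalization hW hH hc']
  refine (entrySum_mul_le _ _).trans ?_
  have h1 := entrySum_mul_le W (Matrix.diagonal fun i => c⁻¹ ^ d i)
  rw [entrySum_diagonal] at h1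
  simp_rw [abs_of_pos (Real.rpow_pos_of_pos hc' _)] at h1
  calc _ ≤ (entrySum W * ∑ i, c⁻¹ ^ d i) * entrySum W⁻¹ :=
        mul_le_mul_of_nonneg_right h1 (entrySum_nonneg _)
    _ = _ := by ring

end EntrySum

/-! ### Integrability of the spectral filter. -/

section Filter

variable {m n : ℕ} {g : Vec ℝ m → Mat ℂ n}

theorem eq_zero_of_exp_I_mul_eq_one {y : ℝ} (hy : |y| ≤ 1) (h : Complex.exp (Complex.I * y) - 1 = 0) :
    y = 0 := by
  have h1 := Complex.norm_exp_I_mul_ofReal_sub_one y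
  rw [h, norm_zero, eq_comm, norm_eq_zero, mul_eq_zero, or_iff_right two_ne_zero] at h1
  have h2 := abs_le.1 hy
  have h3 := Real.pi_gt_three
  have := (Real.sin_eq_zero_iff_of_lt_of_lt (x := y / 2) (by linarith) (by linarith)).1 h1
  linarith

/-- A countable family of directions that separates nonzero points by characters. -/
def separatingPoint (p : Fin m × ℕ) : Vec ℝ m := ((p.2 : ℝ) + 1)⁻¹ • EuclideanSpace.single p.1 1

theorem inner_smul_single (x : Vec ℝ m) (c : ℝ) (j : Fin m) :
    inner ℝ x (c • (EuclideanSpace.single j 1 : Vec ℝ m)) = c * x j := by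
  rw [inner_smul_right, EuclideanSpace.inner_single_right]
  simp

theorem exists_exp_inner_separatingPoint_ne {x : Vec ℝ m} (hx : x ≠ 0) :
    ∃ p, Complex.exp (Complex.I * (inner ℝ x (separatingPoint p) : ℝ)) - 1 ≠ 0 := by
  by_contra! h
  refine hx ?_
  ext j
  obtain ⟨k, hk⟩ := exists_nat_ge |x j|
  have h1 := h (j, k)
  rw [separatingPoint, inner_smul_single] at h1
  have hk0 : (0 : ℝ) < (k : ℝ) + 1 := by positivity
  have := eq_zero_of_exp_I_mul_eq_one ?_ h1
  · rcases mul_eq_zero.1 this with h2 | h2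
    · exact absurd (inv_eq_zero.1 h2) hk0.ne'
    · exact h2
  · rw [abs_mul, abs_of_pos (inv_pos.2 hk0), inv_mul_le_iff₀ hk0]
    linarith

/-- Divide the kernel by its scalar factor wherever that does not vanish; countably many directions
t cover everything but the origin in this way. -/
theorem aestronglyMeasurable_of_harmonizableKernel (hm : 0 < m)
    (hK : ∀ t i j, MemLp (fun x => harmonizableKernel g t x i j) 2 volume) (i j : Fin n) :
    AEStronglyMeasurable (fun x => g x i j) volume := by
  have : Nonempty (Fin m) := ⟨⟨0, hm⟩⟩
  let S : Fin m × ℕ → Set (Vec ℝ m) := fun p =>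
    {x | Complex.exp (Complex.I * (inner ℝ x (separatingPoint p) : ℝ)) - 1 ≠ 0}
  have hcont : ∀ p, Continuous fun x : Vec ℝ m =>
      Complex.exp (Complex.I * (inner ℝ x (separatingPoint p) : ℝ)) - 1 := fun p => by fun_prop
  have hS : ∀ p, MeasurableSet (S p) := fun p =>
    (isOpen_ne.preimage (hcont p)).measurableSet
  have h1 : AEStronglyMeasurable (fun x => g x i j) (volume.restrict (⋃ p, S p)) := by
    rw [aestronglyMeasurable_iUnion_iff]
    intro p
    have h2 : AEStronglyMeasurable (fun x => (Complex.exp (Complex.I *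
        (inner ℝ x (separatingPoint p) : ℝ)) - 1)⁻¹ * harmonizableKernel g (separatingPoint p) x i j)
        (volume.restrict (S p)) :=
      ((hcont p).measurable.inv.aestronglyMeasurable).mul (hK _ i j).1.restrict
    refine h2.congr ((ae_restrict_iff' (hS p)).2 (ae_of_all _ fun x hx => ?_))
    simp only [harmonizableKernel, Matrix.smul_apply, smul_eq_mul]
    rw [← mul_assoc, inv_mul_cancel₀ hx, one_mul]
  rwa [Measure.restrict_congr_set (t := Set.univ), Measure.restrict_univ] at h1
  rw [ae_eq_univ]
  refine measure_mono_null (t := {0}) (fun x hx => ?_) (measure_singleton 0)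
  by_contra h
  obtain ⟨p, hp⟩ := exists_exp_inner_separatingPoint_ne h
  exact hx (Set.mem_iUnion.2 ⟨p, hp⟩)

/-- Finitely many factors e^{i⟨x,t⟩} - 1 have no common zero on D. By compactness the sum of their
squares is bounded below there, so |g|² is at most a constant times a finite sum of squared kernels.
-/
theorem memLp_restrict_of_isCompact {D : Set (Vec ℝ m)} (hD : IsCompact D) (h0 : (0 : Vec ℝ m) ∉ D)
    (hg : ∀ i j, AEStronglyMeasurable (fun x => g x i j) volume)
    (hK : ∀ t i j, MemLp (fun x => harmonizableKernel g t x i j) 2 volume) (i j : Fin n) :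
    MemLp (fun x => g x i j) 2 (volume.restrict D) := by
  obtain ⟨R, hR, hDR⟩ := hD.isBounded.subset_closedBall_lt 0 (0 : Vec ℝ m)
  -- Scaling by 1/R keeps the phases x_l / R in [-1, 1], where the exponential equals 1 only at x_l
  -- = 0.
  let e : Fin m → Vec ℝ m → ℂ := fun l x =>
    Complex.exp (Complex.I * (inner ℝ x (R⁻¹ • (EuclideanSpace.single l 1 : Vec ℝ m)) : ℝ)) - 1
  have hcont : ∀ l, Continuous (e l) := fun l => by fun_prop
  obtain ⟨c, hc, hcD⟩ := hD.exists_forall_le' (f := fun x => ∑ l, ‖e l x‖ ^ 2) (a := 0)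
    (Continuous.continuousOn (by fun_prop)) fun x hx => by
      by_contra h
      have h1 : ∑ l, ‖e l x‖ ^ 2 = 0 :=
        le_antisymm (not_lt.1 h) (Finset.sum_nonneg fun _ _ => by positivity)
      rw [Finset.sum_eq_zero_iff_of_nonneg fun _ _ => by positivity] at h1
      refine h0 ?_
      have : x = 0 := by
        ext l
        have h2 := h1 l (Finset.mem_univ l)
        rw [sq_eq_zero_iff, norm_eq_zero] at h2
        simp only [e, inner_smul_single] at h2
        have hx' : ‖x‖ ≤ R := mem_closedBall_zero_iff.1 (hDR hx)
        have h3 := eq_zero_of_exp_I_mul_eq_one (y := R⁻¹ * x l) ?_ h2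
        · rcases mul_eq_zero.1 h3 with h4 | h4
          · exact absurd (inv_eq_zero.1 h4) hR.ne'
          · exact h4
        · rw [abs_mul, abs_of_pos (inv_pos.2 hR), inv_mul_le_iff₀ hR, mul_one]
          exact (PiLp.norm_apply_le x l).trans hx'
      rwa [← this]
  rw [memLp_two_iff_integrable_sq_norm (hg i j).restrict]
  have hint : Integrable (fun x => c⁻¹ * ∑ l, ‖harmonizableKernel g
      (R⁻¹ • (EuclideanSpace.single l 1 : Vec ℝ m)) x i j‖ ^ 2) (volume.restrict D) := by
    refine Integrable.const_mul (integrable_finsetSum _ fun l _ => ?_) _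
    exact ((memLp_two_iff_integrable_sq_norm (hK _ i j).1).1 (hK _ i j)).restrict
  refine hint.mono' ((hg i j).restrict.norm.pow 2)
    ((ae_restrict_iff' hD.measurableSet).2 (ae_of_all _ fun x hx => ?_))
  rw [Real.norm_of_nonneg (by positivity), le_inv_mul_iff₀ hc]
  have h1 : ∀ l, ‖harmonizableKernel g (R⁻¹ • (EuclideanSpace.single l 1 : Vec ℝ m)) x i j‖ ^ 2 =
      ‖e l x‖ ^ 2 * ‖g x i j‖ ^ 2 := fun l => by
    rw [← mul_pow, ← norm_mul]
    rfl
  simp_rw [h1, ← Finset.sum_mul]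
  exact mul_le_mul_of_nonneg_right (hcD x hx) (by positivity)

/-- Sum the hypothesis over the m eigenvalues, whose total is tr E, and divide by m: h + tr(E)/2 <
tr(E). -/
theorem eigenvalue_lt_half_trace (hm : 0 < m) {E : Mat ℝ m} (hE : RealDiagonalizable E) {h : ℝ}
    (heig : ∀ e ∈ spectrum ℝ E, h + E.trace / 2 < m * e) : h < E.trace / 2 := by
  obtain ⟨W, d, hW, hE⟩ := hE
  have htr : E.trace = ∑ i, d i := by
    rw [hE, Matrix.trace_mul_cycle, Matrix.nonsing_inv_mul _ hW, one_mul, Matrix.trace_diagonal]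
  have : Nonempty (Fin m) := ⟨⟨0, hm⟩⟩
  have h1 : ∑ _i : Fin m, (h + E.trace / 2) < ∑ i, (m : ℝ) * d i :=
    Finset.sum_lt_sum_of_nonempty Finset.univ_nonempty fun i _ =>
      heig _ (mem_spectrum_of_diagonalization hW hE i)
  rw [← Finset.mul_sum, ← htr, Finset.sum_const, Finset.card_univ, Fintype.card_fin,
    nsmul_eq_mul] at h1
  have h2 := lt_of_mul_lt_mul_left h1 (Nat.cast_nonneg m)
  linarith

/-- A homogeneous spectral filter is the sum of an integrable and a square integrable function. -/
theorem exists_integrable_memLp_decomposition (hm : 0 < m) {E : Mat ℝ m} {H : Mat ℝ n}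
    (hE : RealDiagonalizable E) (hEpos : ∀ e ∈ spectrum ℝ E, 0 < e)
    (hH : RealDiagonalizable H) (hpos : ∀ h ∈ spectrum ℝ H, 0 < h)
    (hlt : ∀ h ∈ spectrum ℝ H, h < E.trace / 2)
    (hg_hom : LeftHomogeneous E (-(H + (E.trace / 2) • (1 : Mat ℝ n))) g)
    (hK : ∀ t i j, MemLp (fun x => harmonizableKernel g t x i j) 2 volume) :
    ∃ U : Set (Vec ℝ m), MeasurableSet U ∧ ∀ i j, Integrable (U.indicator fun x => g x i j) ∧
      MemLp (Uᶜ.indicator fun x => g x i j) 2 volume := by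
  have : Nonempty (Fin m) := ⟨⟨0, hm⟩⟩
  obtain ⟨τ, hτc, hτpos, hτ0, hτh, hD⟩ := exists_homogeneous_gauge hE hEpos
  obtain ⟨W, d, hW, hH⟩ := hH
  set a := E.trace / 2 with ha
  obtain ⟨K, hK0, hKle⟩ := exists_entrySum_cpow_le hW hH a
  have hd0 : ∀ k, 0 < d k := fun k => hpos _ (mem_spectrum_of_diagonalization hW hH k)
  have hda : ∀ k, d k < a := fun k => hlt _ (mem_spectrum_of_diagonalization hW hH k)
  set D := {x | 1 ≤ τ x ∧ τ x ≤ 2}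
  have hD0 : (0 : Vec ℝ m) ∉ D := fun h => by
    have := h.1
    rw [hτ0] at this
    linarith
  have hg := aestronglyMeasurable_of_harmonizableKernel hm hK
  have hgD := memLp_restrict_of_isCompact hD hD0 hg hK
  let S : Vec ℝ m → ℝ := fun x => entrySum (g x)
  have hS0 : ∀ x, 0 ≤ S x := fun x => entrySum_nonneg _
  have hSD : MemLp S 2 (volume.restrict D) :=
    memLp_finsetSum _ fun i _ => memLp_finsetSum _ fun j _ => (hgD i j).norm
  have : IsFiniteMeasure (volume.restrict D) := ⟨by simpa using hD.measure_lt_top⟩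
  have hS1 : ∫⁻ x in D, ENNReal.ofReal (S x) < ⊤ := (hSD.integrable one_le_two).lintegral_lt_top
  have hS2 : ∫⁻ x in D, ENNReal.ofReal (S x ^ 2) < ⊤ := hSD.integrable_sq.lintegral_lt_top
  have hSm : AEStronglyMeasurable S volume := by
    refine Finset.aestronglyMeasurable_fun_sum _ fun i _ =>
      Finset.aestronglyMeasurable_fun_sum _ fun j _ => (hg i j).norm
  have hscale : ∀ c : ℝ, 0 < c → ∀ x ∈ D,
      S (act (cpow c E) x) ≤ (c⁻¹ ^ a * (K * ∑ i, c⁻¹ ^ d i)) * S x := fun c hc x hx => by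
    have hx0 : x ≠ 0 := fun h => hD0 (h ▸ hx)
    simp only [S]
    rw [hg_hom c hc x hx0]
    refine (entrySum_mul_le _ _).trans ?_
    rw [entrySum_map_ofReal]
    exact mul_le_mul_of_nonneg_right (hKle c hc) (entrySum_nonneg _)
  have hmem : ∀ c : ℝ, ∀ hc : 0 < c, ∀ x, c ≤ τ x → τ x ≤ 2 * c → x ∈ cpowEquiv hc E '' D :=
    fun c hc x h1 h2 => by
      refine ⟨(cpowEquiv hc E).symm x, ?_, (cpowEquiv hc E).apply_symm_apply x⟩
      rw [cpowEquiv_symm_apply]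
      constructor
      · rw [hτh _ (inv_pos.2 hc), le_inv_mul_iff₀ hc, mul_one]; exact h1
      · rw [hτh _ (inv_pos.2 hc), inv_mul_le_iff₀ hc, mul_comm]; exact h2
  have hdet : ∀ c : ℝ, ∀ hc : 0 < c,
      |LinearMap.det (cpowEquiv hc E : Vec ℝ m →ₗ[ℝ] Vec ℝ m)| = c ^ a * c ^ a := fun c hc => by
    rw [det_cpowEquiv hE, abs_of_pos (Real.rpow_pos_of_pos hc _), ← Real.rpow_add hc, ha]
    congr 1; ring
  have hinv : ∀ c : ℝ, 0 < c → c ^ a * c⁻¹ ^ a = 1 := fun c hc => by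
    rw [Real.inv_rpow hc.le, mul_inv_cancel₀ (Real.rpow_pos_of_pos hc _).ne']
  have hU : MeasurableSet {x | τ x < 1} := (isOpen_Iio.preimage hτc).measurableSet
  refine ⟨{x | τ x < 1}, hU, fun i j => ⟨?_, ?_⟩⟩
  · have h1 : ∫⁻ x in {x | 0 < τ x ∧ τ x < 1}, ENNReal.ofReal (S x) < ⊤ := by
      -- The exponent starts at 1: the shell of scale c is c ≤ τ ≤ 2c, so c = 1/2 already reaches
      -- the boundary τ = 1.
      have hc : ∀ l : ℕ, (0 : ℝ) < (1 / 2) ^ (l + 1) := fun l => by positivity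
      refine setLIntegral_lt_top_of_shells volume hD.measurableSet (fun l => cpowEquiv (hc l) E)
        -- Jacobian c^{2a} times the bound c^{-a-d_k} on the filter gives c^{a-d_k} with c =
        -- 2^{-(l+1)}; this is a convergent geometric series because d_k < a.
        (b := fun l => K * ∑ k, ((1 / 2 : ℝ) ^ (a - d k)) ^ (l + 1)) ?_ ?_ hS1 ?_
      · refine Summable.mul_left _ (summable_sum fun k _ => ?_)
        refine (summable_nat_add_iff 1).2 (summable_geometric_of_lt_one (by positivity) ?_)
        exact Real.rpow_lt_one (by norm_num) (by norm_num) (sub_pos.2 (hda k))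
      · rintro x ⟨hx0, hx1⟩
        obtain ⟨l, hl1, hl2⟩ := exists_nat_pow_near_of_lt_one hx0 hx1.le
          (by norm_num : (0 : ℝ) < 1 / 2) (by norm_num)
        refine Set.mem_iUnion.2 ⟨l, hmem _ (hc l) x hl1.le (hl2.trans (le_of_eq ?_))⟩
        ring
      · intro l x hx
        rw [hdet, ← ENNReal.ofReal_mul (by positivity), ← ENNReal.ofReal_mul (by positivity)]
        refine ENNReal.ofReal_le_ofReal ?_
        set c : ℝ := (1 / 2) ^ (l + 1) with hcdef
        have hc' := hc l
        calc c ^ a * c ^ a * S (act (cpow c E) x)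
            ≤ c ^ a * c ^ a * ((c⁻¹ ^ a * (K * ∑ i, c⁻¹ ^ d i)) * S x) :=
              mul_le_mul_of_nonneg_left (hscale c hc' x hx) (by positivity)
          _ = (c ^ a * c⁻¹ ^ a) * (K * ∑ i, c ^ a * c⁻¹ ^ d i) * S x := by
              rw [← Finset.mul_sum]; ring
          _ = (K * ∑ k, ((1 / 2 : ℝ) ^ (a - d k)) ^ (l + 1)) * S x := by
              rw [hinv c hc', one_mul]
              congr 3 with k
              rw [Real.inv_rpow hc'.le, ← div_eq_mul_inv, ← Real.rpow_sub hc',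
                ← Real.rpow_natCast, ← Real.rpow_natCast, ← Real.rpow_mul (by norm_num),
                ← Real.rpow_mul (by norm_num), mul_comm]
    have h2 : ∫⁻ x in {x | τ x < 1}, ENNReal.ofReal (S x) ≠ ⊤ := by
      refine ne_of_lt (lt_of_eq_of_lt (setLIntegral_congr ?_) h1)
      have h0 : ∀ᵐ x : Vec ℝ m, x ≠ 0 := by
        rw [ae_iff]; simp
      filter_upwards [h0] with x hx
      exact propext ⟨fun h => ⟨hτpos x hx, h⟩, fun h => h.2⟩
    refine (integrable_indicator_iff hU).2 ?_
    have h3 := (lintegral_ofReal_ne_top_iff_integrable hSm.restrict (ae_of_all _ hS0)).1 h2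
    exact h3.mono' (hg i j).restrict (ae_of_all _ fun x => norm_le_entrySum _ i j)
  · have h1 : ∫⁻ x in {x | τ x < 1}ᶜ, ENNReal.ofReal (S x ^ 2) < ⊤ := by
      have hc : ∀ l : ℕ, (0 : ℝ) < 2 ^ l := fun l => by positivity
      refine setLIntegral_lt_top_of_shells volume hD.measurableSet (fun l => cpowEquiv (hc l) E)
        -- Jacobian c^{2a} times the squared bound leaves c^{-d_k-d_k'} with c = 2^l, summable
        -- because the eigenvalues of H are positive.
        (b := fun l => K ^ 2 * ∑ k, ∑ k', ((1 / 2 : ℝ) ^ d k * (1 / 2 : ℝ) ^ d k') ^ l) ?_ ?_ hS2 ?_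
      · refine Summable.mul_left _ (summable_sum fun k _ => summable_sum fun k' _ => ?_)
        refine summable_geometric_of_lt_one (by positivity) ?_
        exact mul_lt_one_of_nonneg_of_lt_one_left (by positivity)
          (Real.rpow_lt_one (by norm_num) (by norm_num) (hd0 k))
          (Real.rpow_lt_one (by norm_num) (by norm_num) (hd0 k')).le
      · intro x hx
        obtain ⟨l, hl1, hl2⟩ := exists_nat_pow_near (not_lt.1 (show ¬τ x < 1 from hx))
          (by norm_num : (1 : ℝ) < 2)
        refine Set.mem_iUnion.2 ⟨l, hmem _ (hc l) x hl1 (hl2.le.trans (le_of_eq ?_))⟩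
        ring
      · intro l x hx
        rw [hdet, ← ENNReal.ofReal_mul (by positivity), ← ENNReal.ofReal_mul (by positivity)]
        refine ENNReal.ofReal_le_ofReal ?_
        set c : ℝ := 2 ^ l with hcdef
        have hc' := hc l
        calc c ^ a * c ^ a * S (act (cpow c E) x) ^ 2
            ≤ c ^ a * c ^ a * ((c⁻¹ ^ a * (K * ∑ i, c⁻¹ ^ d i)) * S x) ^ 2 :=
              mul_le_mul_of_nonneg_left (pow_le_pow_left₀ (hS0 _) (hscale c hc' x hx) 2)
                (by positivity)
          _ = (c ^ a * c⁻¹ ^ a) ^ 2 * (K ^ 2 * ((∑ i, c⁻¹ ^ d i) * ∑ i, c⁻¹ ^ d i)) * S x ^ 2 := by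
              ring
          _ = (K ^ 2 * ∑ k, ∑ k', ((1 / 2 : ℝ) ^ d k * (1 / 2 : ℝ) ^ d k') ^ l) * S x ^ 2 := by
              rw [hinv c hc', one_pow, one_mul, Finset.sum_mul_sum]
              have h4 : ∀ k, c⁻¹ ^ d k = ((1 / 2 : ℝ) ^ d k) ^ l := fun k => by
                rw [hcdef, ← inv_pow, ← Real.rpow_natCast, ← Real.rpow_natCast,
                  ← Real.rpow_mul (by norm_num), ← Real.rpow_mul (by norm_num), mul_comm]
                norm_num
              simp_rw [h4, mul_pow]
    refine (memLp_indicator_iff_restrict hU.compl).2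
      ((memLp_two_iff_integrable_sq_norm (hg i j).restrict).2 ?_)
    have h3 := (lintegral_ofReal_ne_top_iff_integrable (hSm.restrict.pow 2)
      (ae_of_all _ fun x => sq_nonneg _)).1 h1.ne
    refine h3.mono' ((hg i j).restrict.norm.pow 2) (ae_of_all _ fun x => ?_)
    rw [Real.norm_of_nonneg (by positivity)]
    exact pow_le_pow_left₀ (norm_nonneg _) (norm_le_entrySum _ i j) 2

end Filter

/-! ### From almost everywhere homogeneity to exact homogeneity. -/

section Modification

variable {m n : ℕ}

theorem continuous_exp_smul (A : Mat ℝ m) : Continuous fun r : ℝ => NormedSpace.exp (r • A) := by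
  let : NormedRing (Mat ℝ m) := Matrix.linftyOpNormedRing
  let : NormedAlgebra ℝ (Mat ℝ m) := Matrix.linftyOpNormedAlgebra
  let : NormedAlgebra ℚ (Mat ℝ m) := NormedAlgebra.restrictScalars ℚ ℝ _
  exact NormedSpace.exp_continuous.comp (continuous_id.smul continuous_const)

theorem measurable_cpow_apply (A : Mat ℝ m) (i j : Fin m) : Measurable fun c => cpow c A i j :=
  ((continuous_exp_smul A).matrix_elem i j).measurable.comp Real.measurable_log

theorem measurable_act_cpow (A : Mat ℝ m) :
    Measurable fun p : ℝ × Vec ℝ m => act (cpow p.1 A) p.2 := by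
  have h : Continuous fun p : ℝ × Vec ℝ m => act (NormedSpace.exp (p.1 • A)) p.2 :=
    continuous_act_uncurry.comp
      (((continuous_exp_smul A).comp continuous_fst).prodMk continuous_snd)
  exact h.measurable.comp ((Real.measurable_log.comp measurable_fst).prodMk measurable_snd)

theorem ae_Ioi_comp_mul_right {p : ℝ → Prop} {c : ℝ} (hc : 0 < c)
    (h : ∀ᵐ s ∂volume.restrict (Set.Ioi (0 : ℝ)), p s) :
    ∀ᵐ s ∂volume.restrict (Set.Ioi (0 : ℝ)), p (s * c) := by
  rw [ae_restrict_iff' measurableSet_Ioi] at h ⊢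
  have hq : Measure.QuasiMeasurePreserving (fun s : ℝ => s * c) volume volume := by
    refine ⟨measurable_id.mul_const c, ?_⟩
    rw [Real.map_volume_mul_right hc.ne']
    exact Measure.smul_absolutelyContinuous
  filter_upwards [hq.ae h] with s hs hs0
  exact hs (mul_pos hs0 hc)

/-- A function that is homogeneous up to null sets depending on the scale has an exactly
homogeneous modification. -/
theorem exists_leftHomogeneous_ae_eq (E : Mat ℝ m) (Q : Mat ℝ n) {φ : Vec ℝ m → Mat ℝ n}
    (hφ : ∀ i j, AEStronglyMeasurable (fun u => φ u i j) volume)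
    (h : ∀ c : ℝ, 0 < c → ∀ᵐ u, φ (act (cpow c E) u) = cpow c Q * φ u) :
    ∃ φ' : Vec ℝ m → Mat ℝ n, φ' =ᵐ[volume] φ ∧ LeftHomogeneous E Q φ' := by
  let φ₀ : Vec ℝ m → Mat ℝ n := fun u i j => (hφ i j).mk _ u
  have hφ₀ : ∀ i j, Measurable fun u => φ₀ u i j := fun i j => (hφ i j).measurable_mk
  have hφφ₀ : φ =ᵐ[volume] φ₀ := by
    filter_upwards [ae_all_iff.2 fun i => ae_all_iff.2 fun j => (hφ i j).ae_eq_mk] with u hu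
    exact Matrix.ext hu
  have h₀ : ∀ c : ℝ, 0 < c → ∀ᵐ u, φ₀ (act (cpow c E) u) = cpow c Q * φ₀ u := fun c hc => by
    have hq := (quasiMeasurePreserving_continuousLinearEquiv volume (cpowEquiv hc E)).ae hφφ₀
    filter_upwards [h c hc, hφφ₀, hq] with u h1 h2 h3
    rw [← h2, ← h1]
    exact h3.symm
  let μ := volume.restrict (Set.Ioi (0 : ℝ))
  have hμ : NeZero μ := ⟨by simp [μ, Measure.restrict_eq_zero]⟩
  have hpos : ∀ᵐ s ∂μ, 0 < s := ae_restrict_mem measurableSet_Ioi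
  -- Fubini exchanges the quantifiers: the exceptional set of u no longer depends on the scale.
  have hfub : ∀ᵐ u, ∀ᵐ s ∂μ, φ₀ (act (cpow s E) u) = cpow s Q * φ₀ u := by
    have hmeas : MeasurableSet {p : ℝ × Vec ℝ m | φ₀ (act (cpow p.1 E) p.2) =
        cpow p.1 Q * φ₀ p.2} := by
      simp_rw [← Matrix.ext_iff, Set.ofPred_forall, Matrix.mul_apply]
      refine MeasurableSet.iInter fun i => MeasurableSet.iInter fun j =>
        measurableSet_eq_fun ((hφ₀ i j).comp (measurable_act_cpow E)) ?_
      exact Finset.measurable_fun_sum _ fun k _ =>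
        ((measurable_cpow_apply Q i k).comp measurable_fst).mul ((hφ₀ k j).comp measurable_snd)
    refine (Measure.ae_ae_comm hmeas).1 ?_
    filter_upwards [hpos] with s hs using h₀ s hs
  have huniq : ∀ u v w, (∀ᵐ s ∂μ, φ₀ (act (cpow s E) u) = cpow s Q * v) →
      (∀ᵐ s ∂μ, φ₀ (act (cpow s E) u) = cpow s Q * w) → v = w := fun u v w hv hw => by
    obtain ⟨s, hs, h1, h2⟩ := (hpos.and (hv.and hw)).exists
    have h3 := congrArg (cpow s⁻¹ Q * ·) (h1.symm.trans h2)
    simpa [← mul_assoc, cpow_inv_mul_cpow hs] using h3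
  classical
  -- The new value at u is the one v that explains almost all of the orbit of u, namely s^{-Q}
  -- φ₀(s^E u) for almost every s; it is 0 on orbits without such a v.
  let φ' : Vec ℝ m → Mat ℝ n := fun u =>
    if hu : ∃ v, ∀ᵐ s ∂μ, φ₀ (act (cpow s E) u) = cpow s Q * v then hu.choose else 0
  have hφ' : ∀ u v, (∀ᵐ s ∂μ, φ₀ (act (cpow s E) u) = cpow s Q * v) → φ' u = v := fun u v hv => by
    have hu : ∃ v, ∀ᵐ s ∂μ, φ₀ (act (cpow s E) u) = cpow s Q * v := ⟨v, hv⟩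
    simp only [φ', dif_pos hu]
    exact huniq u _ v hu.choose_spec hv
  -- Replacing s by sc preserves null sets, so the property passes along the orbit and v becomes c^Q
  -- v. Applied also with c⁻¹, it shows that the default value 0 is taken on whole orbits.
  have hscale : ∀ c : ℝ, 0 < c → ∀ u v, (∀ᵐ s ∂μ, φ₀ (act (cpow s E) u) = cpow s Q * v) →
      ∀ᵐ s ∂μ, φ₀ (act (cpow s E) (act (cpow c E) u)) = cpow s Q * (cpow c Q * v) :=
    fun c hc u v hv => by
      filter_upwards [ae_Ioi_comp_mul_right hc hv, hpos] with s hs hs0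
      rw [← act_mul, ← cpow_mul hs0 hc, hs, cpow_mul hs0 hc, mul_assoc]
  refine ⟨φ', ?_, fun c hc u _ => ?_⟩
  · filter_upwards [hfub, hφφ₀] with u hu hu'
    rw [hφ' u _ hu, hu']
  · have hmap : (cpow c Q).map (algebraMap ℝ ℝ) = cpow c Q := by ext; simp
    rw [hmap]
    by_cases hu : ∃ v, ∀ᵐ s ∂μ, φ₀ (act (cpow s E) u) = cpow s Q * v
    · obtain ⟨v, hv⟩ := hu
      rw [hφ' u v hv, hφ' _ _ (hscale c hc u v hv)]
    · have hu' : ¬∃ v, ∀ᵐ s ∂μ, φ₀ (act (cpow s E) (act (cpow c E) u)) = cpow s Q * v :=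
        fun ⟨v, hv⟩ => hu ⟨_, by
          simpa [← act_mul, cpow_inv_mul_cpow hc, act_one] using hscale c⁻¹ (inv_pos.2 hc) _ v hv⟩
      simp only [φ', dif_neg hu, dif_neg hu', mul_zero]

end Modification

/-! ### The moving average kernel as a Fourier transform. -/

section SpectralFilter

variable {m n : ℕ} {E : Mat ℝ m} {H : Mat ℝ n} {g F : Vec ℝ m → Mat ℂ n}

theorem act_smul (A : Mat ℝ m) (r : ℝ) (u : Vec ℝ m) : act A (r • u) = r • act A u := by
  simp [act, Matrix.mulVec_smul]

/-- The Fourier transform of a Hermitian filter is real. -/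
theorem IsFourierPair.conj_eq_of_hermitian {γ f : Vec ℝ m → ℂ} (h : IsFourierPair γ f)
    (hγ : ∀ᵐ x, starRingEnd ℂ (γ (-x)) = γ x) : ∀ᵐ u, starRingEnd ℂ (f u) = f u :=
  (h.conj.congr_left hγ).ae_eq h

/-- The increments of the Fourier transform of a filter form the Fourier transform of the
harmonizable kernel. -/
theorem isFourierPair_harmonizableKernel
    (hF : ∀ i j, IsFourierPair (fun x => g x i j) fun u => F u i j)
    (t : Vec ℝ m) (i j : Fin n) :
    IsFourierPair (fun x => harmonizableKernel g t x i j)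
      fun u => F (u - (2 * Real.pi)⁻¹ • t) i j - F u i j := by
  refine (((hF i j).translate ((2 * Real.pi)⁻¹ • t)).sub (hF i j)).congr_left
    (ae_of_all _ fun x => ?_)
  have h : (2 * Real.pi * (inner ℝ x ((2 * Real.pi)⁻¹ • t) : ℝ) * Complex.I : ℂ) =
      Complex.I * (inner ℝ x t : ℝ) := by
    rw [real_inner_smul_right]
    push_cast
    field_simp
  simp only [h, harmonizableKernel, Matrix.smul_apply, smul_eq_mul]
  ring

/-- The Fourier transform of a homogeneous filter is homogeneous. -/
theorem homogeneous_of_isFourierPair (hm : 0 < m) (hE : RealDiagonalizable E)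
    (hg_hom : LeftHomogeneous Eᵀ (-(H + (E.trace / 2) • (1 : Mat ℝ n))) g)
    (hF : ∀ i j, IsFourierPair (fun x => g x i j) fun u => F u i j) {c : ℝ} (hc : 0 < c) :
    ∀ᵐ u, F (act (cpow c E) u) =
      (cpow c (H - (E.trace / 2) • (1 : Mat ℝ n))).map (algebraMap ℝ ℂ) * F u := by
  have : Nonempty (Fin m) := ⟨⟨0, hm⟩⟩
  set a := E.trace / 2 with ha
  have hdE : LinearMap.det (cpowEquiv hc E : Vec ℝ m →ₗ[ℝ] Vec ℝ m) = c ^ a * c ^ a := by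
    rw [det_cpowEquiv hE, ← Real.rpow_add hc, ha, add_halves]
  have hdE' : LinearMap.det (cpowEquiv hc Eᵀ : Vec ℝ m →ₗ[ℝ] Vec ℝ m) = c ^ a * c ^ a := by
    rw [det_cpowEquiv hE.transpose, Matrix.trace_transpose, ← Real.rpow_add hc, ha, add_halves]
  have hca : 0 < c ^ a := Real.rpow_pos_of_pos hc _
  have h0 : ∀ᵐ x : Vec ℝ m, x ≠ 0 := by rw [ae_iff]; simp
  -- Both sides are transforms of x ↦ g(c^{-E*} x), which equals c^{H+aI} g(x) away from 0; the
  -- factor c^{2a} on the left is the determinant of c^E.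
  have key : ∀ i j, ∀ᵐ u, ((c ^ a * c ^ a : ℝ) : ℂ) * F (act (cpow c E) u) i j =
      ∑ k, ((c ^ a * cpow c H i k : ℝ) : ℂ) * F u k j := fun i j => by
    have h1 := (hF i j).comp_linear (cpowEquiv hc E) (cpowEquiv hc Eᵀ)
      (fun u x => by rw [cpowEquiv_apply, cpowEquiv_apply, inner_act, cpow_transpose])
      (by rw [hdE, hdE'])
    rw [hdE, abs_of_pos (mul_pos hca hca)] at h1
    have h2 := IsFourierPair.sum Finset.univ fun k _ =>
      (hF k j).const_mul ((c ^ a * cpow c H i k : ℝ) : ℂ)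
    refine (h1.congr_left ?_).ae_eq h2
    filter_upwards [h0] with x hx
    rw [cpowEquiv_symm_apply, hg_hom _ (inv_pos.2 hc) x hx, cpow_neg, inv_inv,
      cpow_add_smul_one hc, Matrix.mul_apply]
    simp
  filter_upwards [ae_all_iff.2 fun i => ae_all_iff.2 fun j => key i j] with u hu
  ext i j
  have hne : ((c ^ a * c ^ a : ℝ) : ℂ) ≠ 0 := by exact_mod_cast (mul_pos hca hca).ne'
  refine mul_left_cancel₀ hne ((hu i j).trans ?_)
  rw [sub_eq_add_neg, ← neg_smul, cpow_add_smul_one hc, Matrix.mul_apply, Finset.mul_sum]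
  refine Finset.sum_congr rfl fun k _ => ?_
  rw [Matrix.map_apply, Matrix.smul_apply, ← mul_assoc, Real.rpow_neg hc.le]
  congr 1
  simp only [Complex.coe_algebraMap, smul_eq_mul]
  rw [← Complex.ofReal_mul]
  congr 1
  field_simp

/-- A homogeneous spectral filter has a Fourier transform. -/
theorem exists_isFourierPair (hm : 0 < m) (hE : RealDiagonalizable E)
    (hEpos : ∀ e ∈ spectrum ℝ E, 0 < e)
    (hH : RealDiagonalizable H) (hpos : ∀ h ∈ spectrum ℝ H, 0 < h)
    (hlt : ∀ h ∈ spectrum ℝ H, h < E.trace / 2)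
    (hg_hom : LeftHomogeneous E (-(H + (E.trace / 2) • (1 : Mat ℝ n))) g)
    (hK : ∀ t i j, MemLp (fun x => harmonizableKernel g t x i j) 2 volume) :
    ∃ F : Vec ℝ m → Mat ℂ n, ∀ i j, IsFourierPair (fun x => g x i j) fun u => F u i j := by
  obtain ⟨U, -, h⟩ := exists_integrable_memLp_decomposition hm hE hEpos hH hpos hlt hg_hom hK
  refine ⟨fun u i j => _, fun i j =>
    ((IsFourierPair.of_integrable (h i j).1).add (IsFourierPair.of_memLp (h i j).2)).congr_left
      (ae_of_all _ fun x => ?_)⟩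
  exact congrFun (Set.indicator_self_add_compl U _) x

theorem memLp_comp_smul {f : Vec ℝ m → ℂ} (hf : MemLp f 2 volume) {r : ℝ} (hr : r ≠ 0) :
    MemLp (fun u => f (r • u)) 2 volume := by
  refine (memLp_map_measure_iff (g := f) ?_ (measurable_const_smul r).aemeasurable).1 ?_
  · rw [Measure.map_addHaar_smul _ hr]
    exact hf.1.smul_measure _
  · rw [Measure.map_addHaar_smul _ hr]
    exact hf.smul_measure ENNReal.ofReal_ne_top

/-- The moving average kernel attached to a spectral filter. -/
theorem exists_movingAverage_kernel (hm : 0 < m) (hE : RealDiagonalizable E)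
    (hEpos : ∀ e ∈ spectrum ℝ E, 0 < e)
    (hH : RealDiagonalizable H) (hpos : ∀ h ∈ spectrum ℝ H, 0 < h)
    (hlt : ∀ h ∈ spectrum ℝ H, h < E.trace / 2)
    (hg_hom : LeftHomogeneous Eᵀ (-(H + (E.trace / 2) • (1 : Mat ℝ n))) g)
    (hK : ∀ t i j, MemLp (fun x => harmonizableKernel g t x i j) 2 volume)
    (hherm : ∀ t i j, ∀ᵐ x,
      harmonizableKernel g t x i j = starRingEnd ℂ (harmonizableKernel g t (-x) i j)) :
    ∃ φ : Vec ℝ m → Mat ℝ n, LeftHomogeneous E (H - (E.trace / 2) • (1 : Mat ℝ n)) φ ∧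
      (∀ t i j, MemLp (fun u => φ (t - u) i j - φ (-u) i j) 2 volume) ∧
      ∀ s t i j k, ((∫ u, (φ (s - u) i k - φ (-u) i k) * (φ (t - u) j k - φ (-u) j k) : ℝ) : ℂ) =
        ∫ x, harmonizableKernel g s x i k * starRingEnd ℂ (harmonizableKernel g t x j k) := by
  have : Nonempty (Fin m) := ⟨⟨0, hm⟩⟩
  obtain ⟨F, hF⟩ := exists_isFourierPair hm hE.transpose (by rwa [spectrum_transpose]) hH hpos
    (by rwa [Matrix.trace_transpose]) (by rwa [Matrix.trace_transpose]) hK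
  have hD := isFourierPair_harmonizableKernel hF
  -- The factor 2π reconciles the character e^{2πi⟨x,u⟩} of the Fourier transform with e^{i⟨x,t⟩}.
  let ρ : ℝ := 2 * Real.pi
  have hρ : 0 < ρ := Real.two_pi_pos
  -- The square of κ is (2π)^{-m}, which offsets the Jacobian of u ↦ u/(2π) in inner products.
  let κ : ℝ := √((ρ ^ m)⁻¹)
  have hκ : κ * κ = (ρ ^ m)⁻¹ := Real.mul_self_sqrt (by positivity)
  -- The sign makes ψ(t-u) - ψ(-u) an increment of F at u/(2π). Taking real parts commutes with the
  -- real matrices c^Q, so homogeneity survives, and loses nothing on the increments, which are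
  -- real.
  let ψ : Vec ℝ m → Mat ℝ n := fun u => κ • (F (-ρ⁻¹ • u)).map Complex.re
  have hρ' : -ρ⁻¹ ≠ 0 := neg_ne_zero.2 (inv_ne_zero hρ.ne')
  have hqs := Measure.quasiMeasurePreserving_smul (volume : Measure (Vec ℝ m)) hρ'
  have hψm : ∀ i j, AEStronglyMeasurable (fun u => ψ u i j) volume := fun i j =>
    (Complex.continuous_re.comp_aestronglyMeasurable
      ((hF i j).locallyIntegrable.aestronglyMeasurable.comp_quasiMeasurePreserving hqs)).const_mul κ
  have hψh : ∀ c : ℝ, 0 < c → ∀ᵐ u, ψ (act (cpow c E) u) =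
      cpow c (H - (E.trace / 2) • (1 : Mat ℝ n)) * ψ u := fun c hc => by
    filter_upwards [hqs.ae (homogeneous_of_isFourierPair hm hE hg_hom hF hc)] with u hu
    simp only [ψ, ← act_smul, hu, Matrix.mul_smul]
    congr 1
    ext i j
    simp [Matrix.mul_apply]
  obtain ⟨φ, hφψ, hφ⟩ := exists_leftHomogeneous_ae_eq E _ hψm hψh
  have hφD : ∀ t : Vec ℝ m, ∀ᵐ u, ∀ i j, φ (t - u) i j - φ (-u) i j =
      κ * (F (ρ⁻¹ • u - ρ⁻¹ • t) i j - F (ρ⁻¹ • u) i j).re := fun t => by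
    filter_upwards [(quasiMeasurePreserving_sub_left volume t).ae hφψ,
      (Measure.measurePreserving_neg volume).quasiMeasurePreserving.ae hφψ] with u h1 h2 i j
    rw [show φ (t - u) = _ from h1, show φ (-u) = _ from h2]
    have h3 : -ρ⁻¹ • (t - u) = ρ⁻¹ • u - ρ⁻¹ • t := by rw [smul_sub, neg_smul, neg_smul]; abel
    have h4 : -ρ⁻¹ • -u = ρ⁻¹ • u := by simp
    simp only [ψ, h3, h4, Matrix.smul_apply, Matrix.map_apply, smul_eq_mul, Complex.sub_re]
    ring
  have hDm : ∀ t i j, MemLp (fun u => F (u - ρ⁻¹ • t) i j - F u i j) 2 volume :=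
    fun t i j => (hD t i j).memLp (hK t i j)
  have hreal : ∀ t i j, ∀ᵐ u, (((F (u - ρ⁻¹ • t) i j - F u i j).re : ℝ) : ℂ) =
      F (u - ρ⁻¹ • t) i j - F u i j := fun t i j => by
    filter_upwards [(hD t i j).conj_eq_of_hermitian
      (by filter_upwards [hherm t i j] with x hx using hx.symm)] with u hu
    exact Complex.conj_eq_iff_re.1 hu
  refine ⟨φ, hφ, fun t i j => ?_, fun s t i j k => ?_⟩
  · refine (memLp_congr_ae ((hφD t).mono fun u hu => hu i j)).2 (MemLp.const_mul ?_ κ)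
    exact (memLp_comp_smul (hDm t i j) (inv_ne_zero hρ.ne')).re
  · have h1 : ∫ u, (φ (s - u) i k - φ (-u) i k) * (φ (t - u) j k - φ (-u) j k) =
        -- The dilation u ↦ u/(2π) multiplies the integral by (2π)^m, which κ² cancels.
        ∫ u, (F (u - ρ⁻¹ • s) i k - F u i k).re * (F (u - ρ⁻¹ • t) j k - F u j k).re := by
      have h2 := Measure.integral_comp_inv_smul_of_nonneg (volume : Measure (Vec ℝ m))
        (fun u => (F (u - ρ⁻¹ • s) i k - F u i k).re * (F (u - ρ⁻¹ • t) j k - F u j k).re) hρ.le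
      rw [finrank_euclideanSpace_fin] at h2
      have h3 : ∀ x : ℝ, (ρ ^ m)⁻¹ * (ρ ^ m • x) = x := fun x => by
        rw [smul_eq_mul, inv_mul_cancel_left₀ (by positivity)]
      rw [← h3 (∫ u, _ * (F (u - ρ⁻¹ • t) j k - F u j k).re), ← h2, ← integral_const_mul]
      refine integral_congr_ae ?_
      filter_upwards [hφD s, hφD t] with u hs ht
      rw [hs, ht, ← hκ]
      ring
    rw [h1, ← (hD s i k).integral_mul_conj (hD t j k) (hK s i k) (hK t j k),
      ← integral_complex_ofReal]
    refine integral_congr_ae ?_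
    filter_upwards [hreal s i k, hreal t j k] with u hs ht
    rw [Complex.ofReal_mul, hs]
    congr 1
    rw [← Complex.conj_ofReal, ht]

end SpectralFilter

end OFBF

end

/-! ### The moving average representation. -/

open OFBF
theorem theorem3p2
    {m n : ℕ} (hm : 0 < m) (hn : 0 < n)
    (E : Mat ℝ m) (H : Mat ℝ n)
    -- the field
    {Ω : Type*} [MeasurableSpace Ω] (P : Measure Ω) [IsProbabilityMeasure P]
    (B : Vec ℝ m → Ω → Vec ℝ n) (hB : IsOFBF E H B P)
    -- diagonalizability, and the range of the (real) eigenvalues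
    (hE : RealDiagonalizable E) (hH : RealDiagonalizable H)
    (hpos : ∀ h ∈ spectrum ℝ H, 0 < h)
    (hlt : ∀ h ∈ spectrum ℝ H, ∀ e ∈ spectrum ℝ E, h < e)
    (heig : ∀ h ∈ spectrum ℝ H, ∀ e ∈ spectrum ℝ E, h + E.trace / 2 < m * e)
    -- the spectral filter
    (g : Vec ℝ m → Mat ℂ n)
    (hg_hom : LeftHomogeneous Eᵀ (-(H + (Eᵀ.trace / 2) • (1 : Mat ℝ n))) g)
    {Ω₁ : Type*} [MeasurableSpace Ω₁] (P₁ : Measure Ω₁) [IsProbabilityMeasure P₁]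
    (W₁ : Set (Vec ℝ m) → Ω₁ → Vec ℂ n)
    (hW₁ : IsGaussianRandomMeasure W₁ P₁) (hW₁' : IsHermitianMeasure W₁ P₁)
    (hg_repr : HasHarmonizableRepr B P g W₁ P₁)
    -- its mixed partial derivative exists almost everywhere and is bounded on the sphere
    (hg_diff : ∀ᵐ x : Vec ℝ m, ∃ D : Mat ℂ n, HasMixedPartialAt g D x)
    (N : Seminorm ℝ (Vec ℝ m)) (hN : IsPolarNorm Eᵀ N)
    (hg_bdd : ∃ C : ℝ, ∀ θ : Vec ℝ m, N θ = 1 → ∀ D : Mat ℂ n, HasMixedPartialAt g D θ →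
      ∀ i j, ‖D i j‖ ≤ C) :
    ∃ φ : Vec ℝ m → Mat ℝ n,
      (∀ (t : Vec ℝ m) (i j : Fin n),
        MemLp (fun u => φ (t - u) i j - φ (-u) i j) 2 volume) ∧
      LeftHomogeneous E (H - (E.trace / 2) • (1 : Mat ℝ n)) φ ∧
      -- Gaussian random measures with Lebesgue control exist
      (∃ (Ω₂ : Type) (_ : MeasurableSpace Ω₂) (P₂ : Measure Ω₂) (_ : IsProbabilityMeasure P₂)
        (W₂ : Set (Vec ℝ m) → Ω₂ → Vec ℝ n),
        IsGaussianRandomMeasure W₂ P₂ ∧ HasMovingAverageRepr B P φ W₂ P₂) ∧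
      -- and the representation holds with every one of them
      (∀ (Ω₂ : Type*) [MeasurableSpace Ω₂] (P₂ : Measure Ω₂) [IsProbabilityMeasure P₂]
        (W₂ : Set (Vec ℝ m) → Ω₂ → Vec ℝ n),
        IsGaussianRandomMeasure W₂ P₂ → HasMovingAverageRepr B P φ W₂ P₂) := by
  have hK := hg_repr.memLp
  -- Since n > 0, H has an eigenvalue h, and 0 < h < e.
  have hE0 : ∀ e ∈ spectrum ℝ E, 0 < e := fun e he => by
    obtain ⟨W, d, hW, hd⟩ := hH
    have h := mem_spectrum_of_diagonalization hW hd ⟨0, hn⟩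
    exact (hpos _ h).trans (hlt _ h e he)
  rw [Matrix.trace_transpose] at hg_hom
  obtain ⟨φ, hφ, hφL, hφc⟩ := exists_movingAverage_kernel hm hE hE0 hH hpos
    (fun h hh => eigenvalue_lt_half_trace hm hE (heig h hh)) hg_hom hK
    (hg_repr.kernel_hermitian hW₁ hW₁')
  have hcov : ∀ s t i j, ∫ ω, B s ω i * B t ω j ∂P =
      ∑ k, ∫ u, (φ (s - u) i k - φ (-u) i k) * (φ (t - u) j k - φ (-u) j k) := fun s t i j => by
    have h := hg_repr.covariance hW₁ s t i j
    simp_rw [← hφc] at h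
    exact_mod_cast h
  refine ⟨φ, hφL, hφ, ?_, fun Ω₂ _ P₂ _ W₂ hW₂ =>
    hasMovingAverageRepr_of_covariance hB.gaussian hB.mean_zero hφL hcov hW₂⟩
  obtain ⟨Ω₂, _, P₂, _, W₂, hW₂⟩ := exists_isGaussianRandomMeasure m n
  exact ⟨Ω₂, _, P₂, inferInstance, W₂, hW₂,
    hasMovingAverageRepr_of_covariance hB.gaussian hB.mean_zero hφL hcov hW₂⟩
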